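/- Fix an integer $M\ge 1$ and a non-empty finite set of actions ${\bf A}$. For each $a\in{\bf A}$ let $R^a\in\mathbb{R}$ and let $Z(a)$ be a random variable with values in $\{1,\dots,M\}$, $p_m(a)=\mathbb{P}(Z(a)=m)$. The controlled random walk is the Markov decision process on $\{-M,-M+1,\dots\}$ in which negative states are absorbing with zero reward, while choosing $a$ in a state $i\ge 0$ gives the (expected) reward $R^a$ and moves the process to $i-Z(a)$. Let $V(i)$ be the supremum, over all past-dependent randomized strategies, of the total expected reward from the initial state $i$; $V$ satisfies the Bellman equation $$V(i)=\max_{a\in{\bf A}}\Big\{R^a+\sum_{m=1}^M V(i-m)\,p_m(a)\Big\}\ \ (i\ge 0),\qquad V(i)=0\ \ (i<0).\tag{1}$$ Put $L^a=\sum_{m=1}^M m\,p_m(a)$, $c_*=\max_{a\in{\bf A}}R^a/L^a$ and ${\bf A}_*=\{a\in{\bf A}: R^a/L^a=c_*\}$. On ${\bf S}=\{0,\dots,M-1\}$ put $P_{s,j}(a)=p_{s-j}(a)$ if $j<s$, $P_{s,j}(a)=p_{M+s-j}(a)$ if $j\ge s$, and $r_s(a)=L^a(R^a/L^a-c_*)$.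 Let ${\bf D}$ be the set of all mappings (decisions) $d:{\bf S}\to{\bf A}$; for $d\in{\bf D}$ define the vector ${\cal R}(d)\in\mathbb{R}^M$ and the stochastic $M\times M$ matrix ${\cal Q}(d)$ recursively in $l=0,\dots,M-1$ by $${\cal R}_l(d)=r_l(d(l))+\sum_{j<l}P_{l,j}(d(l)){\cal R}_j(d),\qquad {\cal Q}_{l,j}(d)=\sum_{i<l}P_{l,i}(d(l)){\cal Q}_{i,j}(d)+\mathbf{1}_{\{j\ge l\}}P_{l,j}(d(l)).$$ Let ${\cal Q}^*(d)=\lim_{n\to\infty}\frac1n\sum_{k=0}^{n-1}{\cal Q}(d)^k$. A decision $d^*$ is called average optimal if ${\cal Q}^*(d){\cal R}(d)\le{\cal Q}^*(d^*){\cal R}(d^*)$ componentwise for all $d\in{\bf D}$. For $J\ge 1$ let $$\gamma^J=1-\min\ \min_{(s,u)\in{\bf S}^2}\ \sum_{l\in{\bf S}}\min\big\{[{\cal Q}(d^1_1)\cdots{\cal Q}(d^1_J)]_{s,l},\ [{\cal Q}(d^2_1)\cdots{\cal Q}(d^2_J)]_{u,l}\big\},$$ where the first minimum is over all pairs of sequences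 $(d^1_1,\dots,d^1_J)$, $(d^2_1,\dots,d^2_J)$ in ${\bf D}$. **Theorem.** Suppose that (a) for every average optimal $d^*\in{\bf D}$, the Markov chain with transition matrix ${\cal Q}(d^*)$ has no transient states; and (b) either $\gamma^J<1$ for some $J\ge 1$, or, for every average optimal $d^*\in{\bf D}$, the matrix ${\cal Q}(d^*)$ is aperiodic (every recurrent state has period one). Then there is $I<\infty$ such that, for all $i\ge I$, the maximum in (1) is attained only by actions $a\in{\bf A}_*$. -/

import Mathlib

open MeasureTheory ProbabilityTheory Filter Topology

noncomputable section

namespace Turnpike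

/-! ### Finite Markov chains -/

section Chain

variable {M : ℕ}

/-- The probability that the chain with transition matrix `Q`, started at `i`, visits `s` for the
first time (the starting instant is not counted) at time `n + 1`. -/
def firstPassageProb (Q : Matrix (Fin M) (Fin M) ℝ) (s : Fin M) : ℕ → Fin M → ℝ
  | 0, i => Q i s
  | n + 1, i => ∑ j ∈ Finset.univ.erase s, Q i j * firstPassageProb Q s n j

/-- The state `s` is transient: starting from `s`, the chain returns to `s` with probability
strictly smaller than one. -/
def IsTransient (Q : Matrix (Fin M) (Fin M) ℝ) (s : Fin M) : Prop :=
  ∑' n, firstPassageProb Q s n s < 1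

/-- The chain is aperiodic: for every recurrent state `s`, the greatest common divisor of the
possible return times `{n ≥ 1 : (Q ^ n) s s > 0}` is one. -/
def IsAperiodic (Q : Matrix (Fin M) (Fin M) ℝ) : Prop :=
  ∀ s, ¬ IsTransient Q s →
    ∀ k : ℕ, (∀ n : ℕ, 1 ≤ n → 0 < (Q ^ n) s s → k ∣ n) → k = 1

/-- The limiting matrix `Q* = lim (1 / n) ∑_{k < n} Q ^ k` (the limit exists for every stochastic
matrix `Q`). -/
def limitingMatrix (Q : Matrix (Fin M) (Fin M) ℝ) : Matrix (Fin M) (Fin M) ℝ :=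
  limUnder atTop fun n : ℕ => (n : ℝ)⁻¹ • ∑ k ∈ Finset.range n, Q ^ k

end Chain

/-! ### Models with a finite set of decisions -/

section Model

variable {M : ℕ} {D : Type*}

/-- The decision `d₀` is average optimal in the model with rewards `R` and transition matrices
`Q`: its gain `Q*(d₀) R(d₀)` is componentwise maximal. -/
def AverageOptimal (R : D → Fin M → ℝ) (Q : D → Matrix (Fin M) (Fin M) ℝ) (d₀ : D) : Prop :=
  ∀ d, (limitingMatrix (Q d)).mulVec (R d) ≤ (limitingMatrix (Q d₀)).mulVec (R d₀)

/-- The product `Q(δ₁) Q(δ₂) ⋯ Q(δ_J)`, in this order. -/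
def matrixProd (Q : D → Matrix (Fin M) (Fin M) ℝ) {J : ℕ} (δ : Fin J → D) :
    Matrix (Fin M) (Fin M) ℝ :=
  (List.ofFn fun t => Q (δ t)).prod

/-- `η(δ, δ') = min_{s, u} ∑_l min (Q^{(J, δ)}_{s, l}, Q^{(J, δ')}_{u, l})`. -/
def overlap (Q : D → Matrix (Fin M) (Fin M) ℝ) {J : ℕ} (δ δ' : Fin J → D) : ℝ :=
  ⨅ su : Fin M × Fin M, ∑ l, min (matrixProd Q δ su.1 l) (matrixProd Q δ' su.2 l)

/-- `γ^J = 1 - min_{(δ, δ')} η(δ, δ')`, over all pairs of sequences of `J` decisions. -/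
def gammaCoeff (Q : D → Matrix (Fin M) (Fin M) ℝ) (J : ℕ) : ℝ :=
  1 - ⨅ δ : (Fin J → D) × (Fin J → D), overlap Q δ.1 δ.2

end Model

/-! ### The Gauss-Seidel version of a finite Markov decision process -/

section GaussSeidel

variable {M : ℕ} {A : Type*}

/-- `R_l(d) = r_l(d(l)) + ∑_{j < l} P_{l, j}(d(l)) R_j(d)`. -/
def gsReward (P : A → Matrix (Fin M) (Fin M) ℝ) (r : Fin M → A → ℝ) (d : Fin M → A)
    (l : Fin M) : ℝ :=
  r l (d l) + ∑ j : Fin l.1, P (d l) l (j.castLT (j.2.trans l.2)) *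
    gsReward P r d (j.castLT (j.2.trans l.2))
termination_by l.1
decreasing_by exact j.2

/-- `Q_{l, j}(d) = ∑_{i < l} P_{l, i}(d(l)) Q_{i, j}(d)`, with the additional term
`P_{l, j}(d(l))` if `j ≥ l`. -/
def gsTransition (P : A → Matrix (Fin M) (Fin M) ℝ) (d : Fin M → A)
    (l j : Fin M) : ℝ :=
  (∑ i : Fin l.1, P (d l) l (i.castLT (i.2.trans l.2)) *
    gsTransition P d (i.castLT (i.2.trans l.2)) j) + if l ≤ j then P (d l) l j else 0
termination_by l.1
decreasing_by exact i.2

end GaussSeidel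

/-! ### The controlled random walk -/

/-- The data of the walk: for each action `a`, the law of the jump `Z(a)`, with values in
`{1, …, M}`, and the expected reward `R a`. -/
structure ControlledWalk (M : ℕ) (A : Type*) where
  jump : A → PMF (Finset.Icc 1 M)
  R : A → ℝ

/-- The state space `{-M, -M + 1, …}`. -/
abbrev State (M : ℕ) : Type := {x : ℤ // -(M : ℤ) ≤ x}

/-- A pair consisting of the current state `X_t` and the action `A_{t+1}` chosen in it. -/
structure Stage (M : ℕ) (A : Type*) where
  state : State M
  action : A

instance {M : ℕ} {A : Type*} : MeasurableSpace (Stage M A) := ⊤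

instance {M : ℕ} {A : Type*} : DiscreteMeasurableSpace (Stage M A) := ⟨fun _ => trivial⟩

instance {M : ℕ} {A : Type*} [Finite A] : Countable (Stage M A) :=
  Function.Injective.countable (f := fun z : Stage M A => (z.state, z.action)) (by
    rintro ⟨x, a⟩ ⟨y, b⟩ h
    simpa using h)

/-- A past-dependent randomized strategy: having observed `X_0, A_1, …, X_{t-1}, A_t` and `X_t`,
the action `A_{t+1}` is drawn from the given law. -/
def Strategy (M : ℕ) (A : Type*) : Type _ :=
  (t : ℕ) → (Fin t → Stage M A) → State M → PMF A

namespace ControlledWalk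

variable {M : ℕ} {A : Type*} (w : ControlledWalk M A)

/-- `p_m(a)`, the probability that `Z(a) = m`. -/
def p (a : A) (m : ℕ) : ℝ := (((w.jump a).map Subtype.val) m).toReal

/-- `L^a = ∑_m m p_m(a)`. -/
def L (a : A) : ℝ := ∑ m ∈ Finset.Icc 1 M, (m : ℝ) * w.p a m

/-- `c_* = max_a R^a / L^a`. -/
def cStar : ℝ := ⨆ a, w.R a / w.L a

/-- `A_*`, the set of the actions maximising `R^a / L^a`. -/
def AStar : Set A := {a | w.R a / w.L a = w.cStar}

/-- The state reached from `x` by the jump `m`: `x - m` if `x ≥ 0`; negative states are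
absorbing. -/
def next (x : State M) (m : Finset.Icc 1 M) : State M :=
  if h : 0 ≤ x.1 then
    ⟨x.1 - (m.1 : ℤ), by have := (Finset.mem_Icc.1 m.2).2; omega⟩
  else x

/-- The law of the new state when `a` is chosen in `x`. -/
def transition (x : State M) (a : A) : PMF (State M) := (w.jump a).map (next x)

/-- The one-step reward `r_x(a)`. -/
def reward (x : State M) (a : A) : ℝ := if x.1 < 0 then 0 else w.R a

/-- The law of `(X_0, A_1)` under the strategy `π`, with `X_0 = x`. -/
def initialLaw (π : Strategy M A) (x : State M) : Measure (Stage M A) :=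
  ((π 0 Fin.elim0 x).map fun a => (⟨x, a⟩ : Stage M A)).toMeasure

instance (π : Strategy M A) (x : State M) : IsProbabilityMeasure (initialLaw π x) := by
  unfold initialLaw; infer_instance

/-- The conditional law of `(X_{t+1}, A_{t+2})` given `X_0, A_1, …, X_t, A_{t+1}`. -/
def stepKernel [Finite A] (π : Strategy M A) (t : ℕ) :
    Kernel ((_ : Finset.Iic t) → Stage M A) (Stage M A) :=
  Kernel.ofFunOfCountable fun h =>
    ((w.transition (h ⟨t, Finset.mem_Iic.2 le_rfl⟩).state
        (h ⟨t, Finset.mem_Iic.2 le_rfl⟩).action).bind fun y =>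
      (π (t + 1) (fun k => h ⟨k, Finset.mem_Iic.2 (Nat.lt_succ_iff.1 k.2)⟩) y).map
        fun a => (⟨y, a⟩ : Stage M A)).toMeasure

instance [Finite A] (π : Strategy M A) (t : ℕ) : IsMarkovKernel (w.stepKernel π t) :=
  ⟨fun h => by
    change IsProbabilityMeasure (PMF.toMeasure _)
    infer_instance⟩

/-- The strategic measure: the law of the trajectory `(X_0, A_1, X_1, A_2, …)` under the strategy
`π`, with `X_0 = x`. -/
def strategicMeasure [Finite A] (π : Strategy M A) (x : State M) : Measure (ℕ → Stage M A) :=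
  Kernel.trajMeasure (X := fun _ => Stage M A) (initialLaw π x) (w.stepKernel π)

/-- The total expected reward of the strategy `π` from the initial state `x`. -/
def totalReward [Finite A] (π : Strategy M A) (x : State M) : ℝ :=
  ∫ ω, ∑' t, w.reward (ω t).state (ω t).action ∂(w.strategicMeasure π x)

/-- The Bellman function `V`. -/
def V [Finite A] (x : State M) : ℝ := ⨆ π : Strategy M A, w.totalReward π x

/-- The expression `R^a + ∑_m V(x - m) p_m(a)` which is maximised over the actions `a` in the
Bellman equation at a state `x ≥ 0`. -/
def bellmanExpr [Finite A] (x : State M) (a : A) : ℝ :=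
  w.R a + ∑ m : Finset.Icc 1 M, w.V (next x m) * w.p a m

/-- The matrix `P(a)` on the residues `{0, …, M - 1}`: `P_{s, j}(a) = p_{s - j}(a)` if `j < s`,
and `P_{s, j}(a) = p_{M + s - j}(a)` if `j ≥ s`. -/
def P (a : A) : Matrix (Fin M) (Fin M) ℝ :=
  Matrix.of fun s j => if j < s then w.p a (s.1 - j.1) else w.p a (M + s.1 - j.1)

/-- The reduced reward `r_s(a) = L^a (R^a / L^a - c_*)`. -/
def r (_ : Fin M) (a : A) : ℝ := w.L a * (w.R a / w.L a - w.cStar)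

/-- The reward vector of a decision `d`. -/
def decisionReward (d : Fin M → A) : Fin M → ℝ := gsReward w.P w.r d

/-- The transition matrix of a decision `d`. -/
def decisionMatrix (d : Fin M → A) : Matrix (Fin M) (Fin M) ℝ := Matrix.of (gsTransition w.P d)

/-- `d` is an average optimal decision of the model associated with the walk. -/
def IsAverageOptimal (d : Fin M → A) : Prop :=
  AverageOptimal w.decisionReward w.decisionMatrix d

end ControlledWalk

end Turnpike

end

/-!
The relative values `W(i) = V(i) - c_* i` satisfy the Bellman equation with the rewards
`r(a) = L^a (R^a / L^a - c_*)`, which are nonpositive and vanish exactly on `A_*`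
(`ControlledWalk.relValue_ge`, `ControlledWalk.relValue_eq`); in particular `W` is bounded
(`ControlledWalk.abs_relValue_le`). Cutting the half-line into blocks of length `M` turns the
equation into the value iteration `W_{n+1} = max_d (R(d) + Q(d) W_n)` of the associated model
(`ControlledWalk.le_blockValue_succ`, `ControlledWalk.blockValue_succ_eq`).

The main point is that `W_{n+1} - W_n → 0` (`ControlledWalk.tendsto_blockValue_succ_sub`). Fix an
action of `A_*` and let `Q` be the matrix of the constant decision. Its rewards are zero, so it is
average optimal, it has no transient states, and `W_{n+1} ≥ Q W_n`. It has a positive invariant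
measure `μ` (`exists_pos_vecMul_eq`) and is aperiodic: this is assumed in one alternative of the
mixing hypothesis, and in the other one overlapping rows of `Q ^ J` force loops of consecutive
lengths (`isAperiodic_of_forall_exists_pow_pos`). For a bound `K` of `W`, the sums
`∑ μ_s (K - W_n(s))` and `∑ μ_s (K - W_n(s))²` decrease with `n`, hence converge. The decrease of
the first controls `W_{n+1} - Q W_n`; that of the second, over `k` steps, dominates the variances of
`W_n` under the rows of `Q ^ k`, which controls `Q W_n - W_n`
(`tendsto_succ_sub_of_le_mulVec`).

If a decision `d` is maximising for infinitely many blocks, a limit point `h` of the corresponding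
`W_n` therefore satisfies `h = R(d) + Q(d) h`. So `d` has gain zero and is average optimal; as its
chain has no transient states, integrating against a positive invariant measure gives `R(d) = 0`,
and `d` only uses actions of `A_*` (`ControlledWalk.mem_AStar_of_eq_add_mulVec`). As there are
finitely many decisions, all maximising actions in late blocks belong to `A_*`.

That `V` itself satisfies the Bellman equation (`ControlledWalk.solvesBellman_V`) is obtained from
a recursively defined solution `v`: under any strategy the expectations of `v` along the trajectory
telescope, so that `v` exceeds the total reward by the expected sum of the one-step losses, and the
losses vanish for the strategy following the maximising actions
(`ControlledWalk.SolvesBellman.totalReward_add_sum_loss`).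
-/

namespace Turnpike

open Matrix

/-! ### The limiting matrix of a stochastic matrix -/

section LimitingMatrix

variable {M : ℕ} {Q : Matrix (Fin M) (Fin M) ℝ}

/-- The Cesàro average `(1 / n) ∑_{k < n} Q ^ k`. -/
noncomputable def cesaroMean (Q : Matrix (Fin M) (Fin M) ℝ) (n : ℕ) : Matrix (Fin M) (Fin M) ℝ :=
  (n : ℝ)⁻¹ • ∑ k ∈ Finset.range n, Q ^ k

lemma isCompact_rowStochastic :
    IsCompact (rowStochastic ℝ (Fin M) : Set (Matrix (Fin M) (Fin M) ℝ)) := by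
  have hc : IsCompact (Set.univ.pi fun _ : Fin M => Set.univ.pi fun _ : Fin M =>
      Set.Icc (0 : ℝ) 1) :=
    isCompact_univ_pi fun _ => isCompact_univ_pi fun _ => isCompact_Icc
  refine IsCompact.of_isClosed_subset (X := Matrix (Fin M) (Fin M) ℝ) hc ?_ ?_
  · have : (rowStochastic ℝ (Fin M) : Set (Matrix (Fin M) (Fin M) ℝ)) =
        (⋂ i, ⋂ j, {A | 0 ≤ A i j}) ∩ ⋂ i, {A | ∑ j, A i j = 1} := by
      ext A
      simp [mem_rowStochastic_iff_sum]
    rw [this]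
    refine IsClosed.inter (isClosed_iInter fun i => isClosed_iInter fun j => ?_)
      (isClosed_iInter fun i => ?_)
    · exact isClosed_le continuous_const (continuous_id.matrix_elem i j)
    · exact isClosed_eq (continuous_finsetSum _ fun j _ => continuous_id.matrix_elem i j)
        continuous_const
  · intro A hA i _ j _
    exact ⟨nonneg_of_mem_rowStochastic hA, le_one_of_mem_rowStochastic hA⟩

lemma cesaroMean_mem_rowStochastic (hQ : Q ∈ rowStochastic ℝ (Fin M)) {n : ℕ} (hn : 1 ≤ n) :
    cesaroMean Q n ∈ rowStochastic ℝ (Fin M) := by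
  have h := fun k => mem_rowStochastic_iff_sum.1 (pow_mem hQ k)
  have hn' : (n : ℝ) ≠ 0 := by positivity
  refine mem_rowStochastic_iff_sum.2 ⟨fun i j => ?_, fun i => ?_⟩
  · simp only [cesaroMean, Matrix.smul_apply, Matrix.sum_apply, smul_eq_mul]
    exact mul_nonneg (by positivity) (Finset.sum_nonneg fun k _ => (h k).1 i j)
  · simp only [cesaroMean, Matrix.smul_apply, Matrix.sum_apply, smul_eq_mul]
    rw [← Finset.mul_sum, Finset.sum_comm]
    simp [(h _).2, hn']

lemma cesaroMean_mul_sub (Q : Matrix (Fin M) (Fin M) ℝ) (n : ℕ) :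
    cesaroMean Q n * Q - cesaroMean Q n = (n : ℝ)⁻¹ • (Q ^ n - 1) := by
  rw [cesaroMean, smul_mul_assoc, ← smul_sub, ← geom_sum_mul, mul_sub, mul_one]

lemma commute_cesaroMean (Q : Matrix (Fin M) (Fin M) ℝ) (n : ℕ) : Commute (cesaroMean Q n) Q :=
  Commute.smul_left (Commute.sum_left _ _ _ fun k _ => Commute.pow_self Q k) _

lemma tendsto_cesaroMean_mul_sub (hQ : Q ∈ rowStochastic ℝ (Fin M)) :
    Tendsto (fun n => cesaroMean Q n * Q - cesaroMean Q n) atTop (𝓝 0) := by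
  simp_rw [cesaroMean_mul_sub]
  refine tendsto_pi_nhds.2 fun i => tendsto_pi_nhds.2 fun j => ?_
  refine squeeze_zero_norm (a := fun n : ℕ => (n : ℝ)⁻¹ * 1) (fun n => ?_) ?_
  · have h0 := nonneg_of_mem_rowStochastic (pow_mem hQ n) (i := i) (j := j)
    have h1 := le_one_of_mem_rowStochastic (pow_mem hQ n) (i := i) (j := j)
    simp only [Matrix.smul_apply, Matrix.sub_apply, smul_eq_mul, norm_mul, norm_inv,
      Real.norm_natCast]
    gcongr
    rw [Real.norm_eq_abs, abs_le, one_apply]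
    split_ifs <;> constructor <;> linarith
  · simpa using tendsto_inv_atTop_nhds_zero_nat (𝕜 := ℝ)

lemma eq_of_mapClusterPt_of_tendsto {X Y : Type*} [TopologicalSpace X] [TopologicalSpace Y]
    [T2Space Y] {u : ℕ → X} {x : X} {y : Y} {g : X → Y} (hg : Continuous g)
    (hx : MapClusterPt x atTop u) (hy : Tendsto (fun n => g (u n)) atTop (𝓝 y)) : g x = y := by
  have h : MapClusterPt (g x) atTop (g ∘ u) := hx.continuousAt_comp hg.continuousAt
  have h' : ClusterPt (g x) (𝓝 y) := ClusterPt.mono h hy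
  exact eq_of_nhds_neBot h'

/-- The averages `(1 / n) ∑_{k < n} Q ^ k` converge: they stay in a compact set, and any two of
their cluster points `P`, `P'` satisfy `P = P * P' = P'`. -/
lemma exists_tendsto_cesaroMean (hQ : Q ∈ rowStochastic ℝ (Fin M)) :
    ∃ P, Tendsto (cesaroMean Q) atTop (𝓝 P) := by
  have hmem : ∀ᶠ n in atTop, cesaroMean Q n ∈
      (rowStochastic ℝ (Fin M) : Set (Matrix (Fin M) (Fin M) ℝ)) :=
    (eventually_ge_atTop 1).mono fun n hn => cesaroMean_mem_rowStochastic hQ hn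
  have hright : ∀ P, MapClusterPt P atTop (cesaroMean Q) → P * Q = P := fun P hP =>
    sub_eq_zero.1 <| eq_of_mapClusterPt_of_tendsto (g := fun A => A * Q - A) (by fun_prop) hP
      (tendsto_cesaroMean_mul_sub hQ)
  have hleft : ∀ P, MapClusterPt P atTop (cesaroMean Q) → Q * P = P := fun P hP => by
    have hcomm := sub_eq_zero.1 <| eq_of_mapClusterPt_of_tendsto
      (g := fun A => A * Q - Q * A) (y := 0) (by fun_prop) hP
      (by simp [(commute_cesaroMean Q _).eq])
    rw [← hcomm, hright P hP]
  have hpowr : ∀ P, P * Q = P → ∀ k, P * Q ^ k = P := fun P hP k => by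
    induction k with
    | zero => simp
    | succ k ih => rw [pow_succ, ← mul_assoc, ih, hP]
  have hpowl : ∀ P, Q * P = P → ∀ k, Q ^ k * P = P := fun P hP k => by
    induction k with
    | zero => simp
    | succ k ih => rw [pow_succ, mul_assoc, hP, ih]
  have hmul : ∀ P P', MapClusterPt P atTop (cesaroMean Q) →
      MapClusterPt P' atTop (cesaroMean Q) → P * P' = P ∧ P * P' = P' := by
    intro P P' hP hP'
    constructor
    · refine eq_of_mapClusterPt_of_tendsto (g := fun A => P * A) (by fun_prop) hP' ?_
      refine tendsto_const_nhds.congr' ((eventually_ge_atTop 1).mono fun n hn => ?_)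
      have hn' : (n : ℝ) ≠ 0 := by positivity
      simp only [cesaroMean, mul_smul_comm, Finset.mul_sum, hpowr P (hright P hP)]
      simp [← Nat.cast_smul_eq_nsmul ℝ, smul_smul, hn']
    · refine eq_of_mapClusterPt_of_tendsto (g := fun A => A * P') (by fun_prop) hP ?_
      refine tendsto_const_nhds.congr' ((eventually_ge_atTop 1).mono fun n hn => ?_)
      have hn' : (n : ℝ) ≠ 0 := by positivity
      simp only [cesaroMean, smul_mul_assoc, Finset.sum_mul, hpowl P' (hleft P' hP')]
      simp [← Nat.cast_smul_eq_nsmul ℝ, smul_smul, hn']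
  obtain ⟨P, -, hP⟩ := isCompact_rowStochastic.exists_mapClusterPt_of_frequently hmem.frequently
  exact ⟨P, isCompact_rowStochastic.tendsto_nhds_of_unique_mapClusterPt hmem fun P' _ hP' =>
    (hmul P P' hP hP').2.symm.trans (hmul P P' hP hP').1⟩

lemma tendsto_limitingMatrix (hQ : Q ∈ rowStochastic ℝ (Fin M)) :
    Tendsto (cesaroMean Q) atTop (𝓝 (limitingMatrix Q)) :=
  tendsto_nhds_limUnder (exists_tendsto_cesaroMean hQ)

lemma limitingMatrix_mem_rowStochastic (hQ : Q ∈ rowStochastic ℝ (Fin M)) :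
    limitingMatrix Q ∈ rowStochastic ℝ (Fin M) :=
  isCompact_rowStochastic.isClosed.mem_of_tendsto (tendsto_limitingMatrix hQ)
    ((eventually_ge_atTop 1).mono fun _ hn => cesaroMean_mem_rowStochastic hQ hn)

lemma limitingMatrix_mul (hQ : Q ∈ rowStochastic ℝ (Fin M)) :
    limitingMatrix Q * Q = limitingMatrix Q :=
  sub_eq_zero.1 <| tendsto_nhds_unique
    (((continuous_id.matrix_mul continuous_const).sub continuous_id).tendsto _ |>.comp
      (tendsto_limitingMatrix hQ)) (tendsto_cesaroMean_mul_sub hQ)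

lemma limitingMatrix_mul_pow (hQ : Q ∈ rowStochastic ℝ (Fin M)) (k : ℕ) :
    limitingMatrix Q * Q ^ k = limitingMatrix Q := by
  induction k with
  | zero => simp
  | succ k ih => rw [pow_succ, ← mul_assoc, ih, limitingMatrix_mul hQ]

lemma exists_pow_pos_of_limitingMatrix_pos (hQ : Q ∈ rowStochastic ℝ (Fin M)) {s t : Fin M}
    (h : 0 < limitingMatrix Q s t) : ∃ k, 0 < (Q ^ k) s t := by
  by_contra! hle
  have h0 : ∀ k, (Q ^ k) s t = 0 := fun k =>
    le_antisymm (hle k) (nonneg_of_mem_rowStochastic (pow_mem hQ k))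
  have hlim : Tendsto (fun n => cesaroMean Q n s t) atTop (𝓝 (limitingMatrix Q s t)) :=
    ((continuous_id.matrix_elem s t).tendsto _).comp (tendsto_limitingMatrix hQ)
  have hzero : (fun n => cesaroMean Q n s t) = fun _ => 0 := by
    funext n
    simp [cesaroMean, Matrix.sum_apply, h0]
  rw [hzero] at hlim
  exact h.ne (tendsto_nhds_unique tendsto_const_nhds hlim)

end LimitingMatrix

/-! ### Recurrence and aperiodicity -/

section Recurrence

variable {M : ℕ} {Q : Matrix (Fin M) (Fin M) ℝ}

lemma pow_add_pos (hQ : Q ∈ rowStochastic ℝ (Fin M)) {s t u : Fin M} {m n : ℕ}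
    (hm : 0 < (Q ^ m) s t) (hn : 0 < (Q ^ n) t u) : 0 < (Q ^ (m + n)) s u := by
  rw [pow_add, mul_apply]
  exact (mul_pos hm hn).trans_le <| Finset.single_le_sum
    (f := fun j => (Q ^ m) s j * (Q ^ n) j u)
    (fun j _ => mul_nonneg (nonneg_of_mem_rowStochastic (pow_mem hQ m))
      (nonneg_of_mem_rowStochastic (pow_mem hQ n))) (Finset.mem_univ t)

lemma firstPassageProb_nonneg (hQ : Q ∈ rowStochastic ℝ (Fin M)) (s : Fin M) (n : ℕ) (i : Fin M) :
    0 ≤ firstPassageProb Q s n i := by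
  induction n generalizing i with
  | zero => exact nonneg_of_mem_rowStochastic hQ
  | succ n ih =>
    exact Finset.sum_nonneg fun j _ => mul_nonneg (nonneg_of_mem_rowStochastic hQ) (ih j)

lemma firstPassageProb_le_pow (hQ : Q ∈ rowStochastic ℝ (Fin M)) (s : Fin M) (n : ℕ) (i : Fin M) :
    firstPassageProb Q s n i ≤ (Q ^ (n + 1)) i s := by
  induction n generalizing i with
  | zero => simp [firstPassageProb]
  | succ n ih =>
    rw [pow_succ', mul_apply]
    refine (Finset.sum_le_sum fun j _ => mul_le_mul_of_nonneg_left (ih j)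
      (nonneg_of_mem_rowStochastic hQ)).trans ?_
    exact Finset.sum_le_sum_of_subset_of_nonneg (Finset.erase_subset _ _) fun j _ _ =>
      mul_nonneg (nonneg_of_mem_rowStochastic hQ) (nonneg_of_mem_rowStochastic (pow_mem hQ _))

lemma sum_firstPassageProb_succ (Q : Matrix (Fin M) (Fin M) ℝ) (s : Fin M) (N : ℕ) (i : Fin M) :
    ∑ n ∈ Finset.range (N + 1), firstPassageProb Q s n i =
      Q i s + ∑ j ∈ Finset.univ.erase s,
        Q i j * ∑ n ∈ Finset.range N, firstPassageProb Q s n j := by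
  rw [Finset.sum_range_succ', add_comm]
  simp only [firstPassageProb, Finset.mul_sum]
  rw [Finset.sum_comm]

lemma sum_firstPassageProb_le_one (hQ : Q ∈ rowStochastic ℝ (Fin M)) (s : Fin M) (N : ℕ)
    (i : Fin M) : ∑ n ∈ Finset.range N, firstPassageProb Q s n i ≤ 1 := by
  induction N generalizing i with
  | zero => simp
  | succ N ih =>
    rw [sum_firstPassageProb_succ, ← sum_row_of_mem_rowStochastic hQ i,
      ← Finset.add_sum_erase _ _ (Finset.mem_univ s)]
    gcongr with j _
    exact mul_le_of_le_one_right (nonneg_of_mem_rowStochastic hQ) (ih j)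

lemma summable_firstPassageProb (hQ : Q ∈ rowStochastic ℝ (Fin M)) (s i : Fin M) :
    Summable fun n => firstPassageProb Q s n i :=
  summable_of_sum_range_le (fun n => firstPassageProb_nonneg hQ s n i)
    fun N => sum_firstPassageProb_le_one hQ s N i

lemma tsum_firstPassageProb_eq (hQ : Q ∈ rowStochastic ℝ (Fin M)) (s i : Fin M) :
    ∑' n, firstPassageProb Q s n i =
      Q i s + ∑ j ∈ Finset.univ.erase s, Q i j * ∑' n, firstPassageProb Q s n j := by
  rw [(summable_firstPassageProb hQ s i).tsum_eq_zero_add]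
  simp only [firstPassageProb]
  rw [Summable.tsum_finsetSum fun j _ => (summable_firstPassageProb hQ s j).mul_left _]
  simp only [tsum_mul_left]

/-- From a non-transient state one can return from wherever one can go. The probability `h i` of
ever visiting `s` from `i` is a harmonic function bounded by `1`; since `h s = 1`, it equals `1` at
every state which can be reached from `s`. -/
lemma exists_pow_pos_of_not_isTransient (hQ : Q ∈ rowStochastic ℝ (Fin M)) {s t : Fin M}
    (hs : ¬ IsTransient Q s) {n : ℕ} (hst : 0 < (Q ^ n) s t) : ∃ k, 0 < (Q ^ k) t s := by
  by_contra! hle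
  have hzero : ∀ k, (Q ^ k) t s = 0 := fun k =>
    le_antisymm (hle k) (nonneg_of_mem_rowStochastic (pow_mem hQ k))
  set h : Fin M → ℝ := fun i => ∑' n, firstPassageProb Q s n i with hh
  have h_le : ∀ i, h i ≤ 1 := fun i =>
    (summable_firstPassageProb hQ s i).tsum_le_of_sum_range_le
      fun N => sum_firstPassageProb_le_one hQ s N i
  have h_s : h s = 1 := le_antisymm (h_le s) (not_lt.1 hs)
  have h_t : h t = 0 := by
    have : ∀ n, firstPassageProb Q s n t = 0 := fun n =>
      le_antisymm ((firstPassageProb_le_pow hQ s n t).trans (hle _))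
        (firstPassageProb_nonneg hQ s n t)
    simp [hh, this]
  have harm : Q *ᵥ h = h := by
    funext i
    rw [mulVec, dotProduct, ← Finset.add_sum_erase _ _ (Finset.mem_univ s), h_s, mul_one]
    exact (tsum_firstPassageProb_eq hQ s i).symm
  have harm_pow : ∀ n, Q ^ n *ᵥ h = h := fun n => by
    induction n with
    | zero => simp
    | succ n ih => rw [pow_succ, ← mulVec_mulVec, harm, ih]
  have hlt : (Q ^ n *ᵥ h) s < 1 := by
    rw [mulVec, dotProduct, ← sum_row_of_mem_rowStochastic (pow_mem hQ n) s]
    refine Finset.sum_lt_sum (fun j _ => mul_le_of_le_one_right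
      (nonneg_of_mem_rowStochastic (pow_mem hQ n)) (h_le j)) ⟨t, Finset.mem_univ t, ?_⟩
    simpa [h_t] using hst
  rw [harm_pow, h_s] at hlt
  exact lt_irrefl _ hlt

/-- A stochastic matrix without transient states has a positive invariant measure: the column sums
of its limiting matrix. -/
lemma exists_pos_vecMul_eq (hQ : Q ∈ rowStochastic ℝ (Fin M)) (hrec : ∀ s, ¬ IsTransient Q s) :
    ∃ μ : Fin M → ℝ, (∀ s, 0 < μ s) ∧ μ ᵥ* Q = μ := by
  have hQ' := limitingMatrix_mem_rowStochastic hQ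
  refine ⟨1 ᵥ* limitingMatrix Q, fun s => ?_, by rw [vecMul_vecMul, limitingMatrix_mul hQ]⟩
  have hdiag : 0 < limitingMatrix Q s s := by
    obtain ⟨t, -, ht⟩ : ∃ t ∈ Finset.univ, 0 < limitingMatrix Q s t := by
      apply Finset.exists_lt_of_sum_lt
      simp [sum_row_of_mem_rowStochastic hQ' s]
    obtain ⟨k, hk⟩ := exists_pow_pos_of_limitingMatrix_pos hQ ht
    obtain ⟨n, hn⟩ := exists_pow_pos_of_not_isTransient hQ (hrec s) hk
    rw [← limitingMatrix_mul_pow hQ n, mul_apply]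
    exact (mul_pos ht hn).trans_le <| Finset.single_le_sum
      (f := fun j => limitingMatrix Q s j * (Q ^ n) j s)
      (fun j _ => mul_nonneg (nonneg_of_mem_rowStochastic hQ')
        (nonneg_of_mem_rowStochastic (pow_mem hQ n))) (Finset.mem_univ t)
  simp only [vecMul, dotProduct, Pi.one_apply, one_mul]
  exact hdiag.trans_le <| Finset.single_le_sum (f := fun i => limitingMatrix Q i s)
    (fun i _ => nonneg_of_mem_rowStochastic hQ') (Finset.mem_univ s)

/-- An aperiodic chain without transient states can be back at its starting point at every
sufficiently late time. -/
lemma exists_forall_pow_self_pos (hQ : Q ∈ rowStochastic ℝ (Fin M))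
    (hrec : ∀ s, ¬ IsTransient Q s) (hap : IsAperiodic Q) :
    ∃ N, ∀ n ≥ N, ∀ s, 0 < (Q ^ n) s s := by
  have key : ∀ s, ∃ N, ∀ n ≥ N, 0 < (Q ^ n) s s := by
    intro s
    let T : AddSubmonoid ℕ :=
      { carrier := {n | 0 < (Q ^ n) s s}
        zero_mem' := by simp
        add_mem' := fun hm hn => pow_add_pos hQ hm hn }
    have hgcd : Nat.setGcd (T : Set ℕ) = 1 :=
      hap s (hrec s) _ fun n _ hn => Nat.setGcd_dvd_of_mem (show n ∈ (T : Set ℕ) from hn)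
    obtain ⟨N, hN⟩ := Nat.exists_mem_closure_of_ge (T : Set ℕ)
    refine ⟨N, fun n hn => ?_⟩
    have := hN n hn (by simp [hgcd])
    rwa [AddSubmonoid.closure_eq] at this
  choose N hN using key
  exact ⟨Finset.univ.sup N, fun n hn s => hN s n ((Finset.le_sup (Finset.mem_univ s)).trans hn)⟩

/-- If any two rows of a power of `Q` overlap, a chain without transient states is aperiodic:
going from `s` to a common successor `l` of `s` and of a neighbour of `s`, and back, yields loops
at `s` of two consecutive lengths. -/
lemma isAperiodic_of_forall_exists_pow_pos (hQ : Q ∈ rowStochastic ℝ (Fin M))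
    (hrec : ∀ s, ¬ IsTransient Q s) {J : ℕ} (hJ : 1 ≤ J)
    (h : ∀ s u, ∃ l, 0 < (Q ^ J) s l ∧ 0 < (Q ^ J) u l) : IsAperiodic Q := by
  intro s hs k hk
  obtain ⟨u, -, hu⟩ : ∃ u ∈ Finset.univ, 0 < Q s u := by
    apply Finset.exists_lt_of_sum_lt
    simp [sum_row_of_mem_rowStochastic hQ s]
  obtain ⟨l, hsl, hul⟩ := h s u
  obtain ⟨n, hn⟩ := exists_pow_pos_of_not_isTransient hQ (hrec s) hsl
  have h1 := hk (J + n) (by omega) (pow_add_pos hQ hsl hn)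
  have h2 := hk (1 + (J + n)) (by omega)
    (pow_add_pos hQ (by simpa using hu) (pow_add_pos hQ hul hn))
  exact Nat.dvd_one.1 ((Nat.dvd_add_left h1).1 h2)

lemma exists_pow_pos_of_gammaCoeff_lt_one {D : Type*} [Finite D]
    {Q : D → Matrix (Fin M) (Fin M) ℝ} (d : D) {J : ℕ} (h : gammaCoeff Q J < 1) (s u : Fin M) :
    ∃ l, 0 < (Q d ^ J) s l ∧ 0 < (Q d ^ J) u l := by
  have hprod : matrixProd Q (fun _ : Fin J => d) = Q d ^ J := by
    simp [matrixProd, List.ofFn_const]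
  have h1 : 0 < ⨅ δ : (Fin J → D) × (Fin J → D), overlap Q δ.1 δ.2 := by
    unfold gammaCoeff at h
    linarith
  have h2 : 0 < overlap Q (fun _ : Fin J => d) fun _ => d :=
    h1.trans_le (ciInf_le (Set.finite_range _).bddBelow
      ((fun _ => d, fun _ => d) : (Fin J → D) × (Fin J → D)))
  have h3 : 0 < ∑ l, min ((Q d ^ J) s l) ((Q d ^ J) u l) := by
    rw [overlap, hprod] at h2
    exact h2.trans_le (ciInf_le (Set.finite_range _).bddBelow ((s, u) : Fin M × Fin M))
  obtain ⟨l, -, hl⟩ : ∃ l ∈ Finset.univ, 0 < min ((Q d ^ J) s l) ((Q d ^ J) u l) := by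
    apply Finset.exists_lt_of_sum_lt
    simpa using h3
  exact ⟨l, lt_min_iff.1 hl⟩

end Recurrence

/-! ### Subharmonic sequences of a recurrent aperiodic chain -/

section AsymptoticRegularity

variable {M : ℕ} {Q : Matrix (Fin M) (Fin M) ℝ} {μ : Fin M → ℝ} {U : ℕ → Fin M → ℝ}

lemma mulVec_mono (hQ : Q ∈ rowStochastic ℝ (Fin M)) {x y : Fin M → ℝ} (h : x ≤ y) :
    Q *ᵥ x ≤ Q *ᵥ y := by
  intro s
  simp only [mulVec, dotProduct]
  exact Finset.sum_le_sum fun j _ => mul_le_mul_of_nonneg_left (h j) (nonneg_of_mem_rowStochastic hQ)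

lemma le_pow_mulVec (hQ : Q ∈ rowStochastic ℝ (Fin M)) (hU : ∀ n, U (n + 1) ≤ Q *ᵥ U n)
    (n k : ℕ) : U (n + k) ≤ Q ^ k *ᵥ U n := by
  induction k with
  | zero => simp
  | succ k ih =>
    rw [pow_succ', ← mulVec_mulVec]
    exact (hU (n + k)).trans (mulVec_mono hQ ih)

lemma vecMul_pow_eq (hμ : μ ᵥ* Q = μ) (k : ℕ) : μ ᵥ* Q ^ k = μ := by
  induction k with
  | zero => simp
  | succ k ih => rw [pow_succ, ← vecMul_vecMul, ih, hμ]

/-- The `μ`-average of the variances of `U n` under the rows of `Q ^ k` is at most the decrease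
of `∑ s, μ s * U n s ^ 2` over `k` steps. -/
lemma sum_variance_le (hQ : Q ∈ rowStochastic ℝ (Fin M)) (hμ0 : ∀ s, 0 < μ s) (hμ : μ ᵥ* Q = μ)
    (hU0 : ∀ n s, 0 ≤ U n s) (hU : ∀ n, U (n + 1) ≤ Q *ᵥ U n) (n k : ℕ) :
    ∑ s, μ s * ∑ t, (Q ^ k) s t * (U n t - (Q ^ k *ᵥ U n) s) ^ 2 ≤
      ∑ s, μ s * U n s ^ 2 - ∑ s, μ s * U (n + k) s ^ 2 := by
  have hvar : ∀ s, ∑ t, (Q ^ k) s t * (U n t - (Q ^ k *ᵥ U n) s) ^ 2 =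
      (Q ^ k *ᵥ fun t => U n t ^ 2) s - (Q ^ k *ᵥ U n) s ^ 2 := by
    intro s
    have h1 := sum_row_of_mem_rowStochastic (pow_mem hQ k) s
    set m := (Q ^ k *ᵥ U n) s with hm
    have hm' : ∑ t, (Q ^ k) s t * U n t = m := rfl
    have : ∀ t, (Q ^ k) s t * (U n t - m) ^ 2 =
        (Q ^ k) s t * U n t ^ 2 - 2 * m * ((Q ^ k) s t * U n t) + m ^ 2 * (Q ^ k) s t := by
      intro t
      ring
    simp only [this, Finset.sum_add_distrib, Finset.sum_sub_distrib, ← Finset.mul_sum, h1, hm']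
    simp only [mulVec, dotProduct]
    ring
  have hinv : ∑ s, μ s * (Q ^ k *ᵥ fun t => U n t ^ 2) s = ∑ s, μ s * U n s ^ 2 := by
    change μ ⬝ᵥ (Q ^ k *ᵥ fun t => U n t ^ 2) = μ ⬝ᵥ fun t => U n t ^ 2
    rw [dotProduct_mulVec, vecMul_pow_eq hμ]
  simp only [hvar, mul_sub, Finset.sum_sub_distrib, hinv]
  refine sub_le_sub_left (Finset.sum_le_sum fun s _ => ?_) _
  exact mul_le_mul_of_nonneg_left
    (pow_le_pow_left₀ (hU0 _ s) (le_pow_mulVec hQ hU n k s) 2) (hμ0 s).le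

lemma tendsto_sub_of_antitone {Φ : ℕ → ℝ} (hΦ : Antitone Φ) (h0 : ∀ n, 0 ≤ Φ n) (k : ℕ) :
    Tendsto (fun n => Φ n - Φ (n + k)) atTop (𝓝 0) := by
  have h := tendsto_atTop_ciInf hΦ ⟨0, by rintro _ ⟨n, rfl⟩; exact h0 n⟩
  simpa using h.sub (h.comp (tendsto_add_atTop_nat k))

/-- Let `Q` be stochastic with a positive invariant measure, and let each of its states be its own
successor at every late time. Then a nonnegative sequence with `U (n + 1) ≤ Q U n` is asymptotically
regular. Two quantities decrease along it: `∑ s, μ s * U n s`, so that `U (n + 1) - Q U n` vanishes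
in the limit, and `∑ s, μ s * U n s ^ 2`, so that by `sum_variance_le` the values of `U n` at the
possible successors of a state merge. -/
lemma tendsto_succ_sub_of_le_mulVec (hQ : Q ∈ rowStochastic ℝ (Fin M)) (hμ0 : ∀ s, 0 < μ s)
    (hμ : μ ᵥ* Q = μ) {N : ℕ} (hN : ∀ n ≥ N, ∀ s, 0 < (Q ^ n) s s)
    (hU0 : ∀ n s, 0 ≤ U n s) (hU : ∀ n, U (n + 1) ≤ Q *ᵥ U n) (s : Fin M) :
    Tendsto (fun n => U (n + 1) s - U n s) atTop (𝓝 0) := by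
  have hpow : ∀ k s t, 0 ≤ (Q ^ k) s t := fun k s t => nonneg_of_mem_rowStochastic (pow_mem hQ k)
  have hterm : ∀ k n s t,
      0 ≤ (Q ^ k) s t * (U n t - (Q ^ k *ᵥ U n) s) ^ 2 := fun k n s t =>
    mul_nonneg (hpow k s t) (sq_nonneg _)
  have hsum : ∀ k n s, 0 ≤ ∑ t, (Q ^ k) s t * (U n t - (Q ^ k *ᵥ U n) s) ^ 2 := fun k n s =>
    Finset.sum_nonneg fun t _ => hterm k n s t
  have hΦ : Antitone fun n => ∑ s, μ s * U n s ^ 2 := by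
    refine antitone_nat_of_succ_le fun n => sub_nonneg.1 ?_
    exact (Finset.sum_nonneg fun s _ => mul_nonneg (hμ0 s).le (hsum 1 n s)).trans
      (sum_variance_le hQ hμ0 hμ hU0 hU n 1)
  have hmean : ∀ k s t, 0 < (Q ^ k) s t →
      Tendsto (fun n => U n t - (Q ^ k *ᵥ U n) s) atTop (𝓝 0) := by
    intro k s t hst
    have hlim := (tendsto_sub_of_antitone hΦ
      (fun n => Finset.sum_nonneg fun s _ => mul_nonneg (hμ0 s).le (sq_nonneg _)) k).const_mul
      ((μ s * (Q ^ k) s t)⁻¹)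
    rw [mul_zero] at hlim
    have hsq : Tendsto (fun n => (U n t - (Q ^ k *ᵥ U n) s) ^ 2) atTop (𝓝 0) := by
      refine squeeze_zero (fun n => sq_nonneg _) (fun n => ?_) hlim
      rw [le_inv_mul_iff₀ (mul_pos (hμ0 s) hst), mul_assoc]
      refine le_trans ?_ (sum_variance_le hQ hμ0 hμ hU0 hU n k)
      refine le_trans (mul_le_mul_of_nonneg_left ?_ (hμ0 s).le)
        (Finset.single_le_sum (f := fun s => μ s * ∑ t, (Q ^ k) s t *
          (U n t - (Q ^ k *ᵥ U n) s) ^ 2)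
          (fun s _ => mul_nonneg (hμ0 s).le (hsum k n s)) (Finset.mem_univ s))
      exact Finset.single_le_sum (f := fun t => (Q ^ k) s t *
        (U n t - (Q ^ k *ᵥ U n) s) ^ 2) (fun t _ => hterm k n s t) (Finset.mem_univ t)
    have habs := hsq.sqrt
    simp only [Real.sqrt_sq_eq_abs, Real.sqrt_zero] at habs
    exact (tendsto_zero_iff_abs_tendsto_zero _).2 habs
  have hstep : ∀ t, Tendsto (fun n => Q s t * (U n t - U n s)) atTop (𝓝 0) := by
    intro t
    rcases (nonneg_of_mem_rowStochastic hQ : 0 ≤ Q s t).eq_or_lt with h | h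
    · simp [← h]
    -- both `s` and its successor `t` can be reached from `s` in exactly `N + 1` steps
    · have h1 := hmean (N + 1) s t
        (pow_add_pos hQ (hN N le_rfl s) (by simpa using h))
      have h2 := hmean (N + 1) s s (hN _ (Nat.le_succ N) s)
      simpa using (h1.sub h2).const_mul (Q s t)
  have hloc : Tendsto (fun n => (Q *ᵥ U n) s - U n s) atTop (𝓝 0) := by
    have := tendsto_finsetSum Finset.univ fun t _ => hstep t
    simpa [mul_sub, Finset.sum_sub_distrib, ← Finset.sum_mul, sum_row_of_mem_rowStochastic hQ,
      mulVec, dotProduct] using this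
  have hgap0 : ∀ n s, 0 ≤ (Q *ᵥ U n) s - U (n + 1) s := fun n s => sub_nonneg.2 (hU n s)
  have hgap_sum : ∀ n, ∑ s, μ s * ((Q *ᵥ U n) s - U (n + 1) s) =
      ∑ s, μ s * U n s - ∑ s, μ s * U (n + 1) s := by
    intro n
    simp only [mul_sub, Finset.sum_sub_distrib]
    congr 1
    change μ ⬝ᵥ (Q *ᵥ U n) = μ ⬝ᵥ U n
    rw [dotProduct_mulVec, hμ]
  have hψ : Antitone fun n => ∑ s, μ s * U n s := by
    refine antitone_nat_of_succ_le fun n => sub_nonneg.1 ?_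
    rw [← hgap_sum]
    exact Finset.sum_nonneg fun s _ => mul_nonneg (hμ0 s).le (hgap0 n s)
  have hgap : Tendsto (fun n => (Q *ᵥ U n) s - U (n + 1) s) atTop (𝓝 0) := by
    have hlim := (tendsto_sub_of_antitone hψ
      (fun n => Finset.sum_nonneg fun s _ => mul_nonneg (hμ0 s).le (hU0 n s)) 1).const_mul
      ((μ s)⁻¹)
    rw [mul_zero] at hlim
    refine squeeze_zero (fun n => hgap0 n s) (fun n => ?_) hlim
    rw [le_inv_mul_iff₀ (hμ0 s), ← hgap_sum]
    exact Finset.single_le_sum (f := fun s => μ s * ((Q *ᵥ U n) s - U (n + 1) s))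
      (fun s _ => mul_nonneg (hμ0 s).le (hgap0 n s)) (Finset.mem_univ s)
  simpa using hloc.sub hgap

end AsymptoticRegularity

/-! ### Gauss-Seidel recursion -/

section GaussSeidelStep

variable {M : ℕ} {A : Type*}

lemma sum_castLT_eq (l : Fin M) (f : Fin M → ℝ) :
    ∑ i : Fin l.1, f (i.castLT (i.2.trans l.2)) = ∑ j, if j < l then f j else 0 := by
  rw [← Finset.sum_filter]
  refine Finset.sum_bij (fun i _ => i.castLT (i.2.trans l.2)) (fun i _ => ?_) (fun i _ j _ h => ?_)
    (fun j hj => ?_) (fun i _ => rfl)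
  · exact Finset.mem_filter.2 ⟨Finset.mem_univ _, i.2⟩
  · simpa [Fin.ext_iff] using h
  · exact ⟨⟨j.1, (Finset.mem_filter.1 hj).2⟩, Finset.mem_univ _, rfl⟩

/-- The Gauss-Seidel iterate `R(d) + Q(d) x` is computed state by state, using its own components
at the states below the current one, and `x` at the others. -/
lemma gsReward_add_mulVec_apply (P : A → Matrix (Fin M) (Fin M) ℝ) (r : Fin M → A → ℝ)
    (d : Fin M → A) (x : Fin M → ℝ) (l : Fin M) :
    (gsReward P r d + Matrix.of (gsTransition P d) *ᵥ x) l = r l (d l) +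
      ∑ j, P (d l) l j *
        (if j < l then (gsReward P r d + Matrix.of (gsTransition P d) *ᵥ x) j else x j) := by
  have hR : gsReward P r d l =
      r l (d l) + ∑ j, if j < l then P (d l) l j * gsReward P r d j else 0 := by
    rw [gsReward, sum_castLT_eq l fun j => P (d l) l j * gsReward P r d j]
  have hQ : ∀ j, gsTransition P d l j =
      (∑ i, if i < l then P (d l) l i * gsTransition P d i j else 0) +
        if l ≤ j then P (d l) l j else 0 := by
    intro j
    rw [gsTransition, sum_castLT_eq l fun i => P (d l) l i * gsTransition P d i j]
  have hQx : (Matrix.of (gsTransition P d) *ᵥ x) l =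
      (∑ i, if i < l then P (d l) l i * (Matrix.of (gsTransition P d) *ᵥ x) i else 0) +
        ∑ j, if l ≤ j then P (d l) l j * x j else 0 := by
    simp only [mulVec, dotProduct, Matrix.of_apply]
    simp_rw [hQ, add_mul, Finset.sum_add_distrib, Finset.sum_mul, ite_mul, zero_mul]
    rw [Finset.sum_comm]
    congr 1
    refine Finset.sum_congr rfl fun i _ => ?_
    split_ifs
    · simp_rw [Finset.mul_sum, mul_assoc]
    · simp
  rw [Pi.add_apply, hR, hQx, add_assoc, ← Finset.sum_add_distrib, ← add_assoc,
    add_assoc (r l (d l)), ← Finset.sum_add_distrib]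
  congr 1
  refine Finset.sum_congr rfl fun j _ => ?_
  by_cases h : j < l
  · simp [h, not_le.2 h, mul_add]
  · simp [h, not_lt.1 h]

lemma gsReward_nonpos {P : A → Matrix (Fin M) (Fin M) ℝ} {r : Fin M → A → ℝ}
    (hP : ∀ a l j, 0 ≤ P a l j) (hr : ∀ l a, r l a ≤ 0) (d : Fin M → A) (l : Fin M) :
    gsReward P r d l ≤ 0 := by
  induction l using WellFoundedLT.induction with
  | ind l ih =>
    rw [gsReward]
    exact add_nonpos (hr _ _) (Finset.sum_nonpos fun j _ =>
      mul_nonpos_of_nonneg_of_nonpos (hP _ _ _) (ih _ j.2))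

lemma gsReward_le {P : A → Matrix (Fin M) (Fin M) ℝ} {r : Fin M → A → ℝ}
    (hP : ∀ a l j, 0 ≤ P a l j) (hr : ∀ l a, r l a ≤ 0) (d : Fin M → A) (l : Fin M) :
    gsReward P r d l ≤ r l (d l) := by
  rw [gsReward]
  exact add_le_of_nonpos_right (Finset.sum_nonpos fun j _ =>
    mul_nonpos_of_nonneg_of_nonpos (hP _ _ _) (gsReward_nonpos hP hr d _))

lemma gsReward_eq_zero {P : A → Matrix (Fin M) (Fin M) ℝ} {r : Fin M → A → ℝ} {d : Fin M → A}
    (hr : ∀ l, r l (d l) = 0) (l : Fin M) : gsReward P r d l = 0 := by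
  induction l using WellFoundedLT.induction with
  | ind l ih =>
    rw [gsReward, hr, zero_add]
    exact Finset.sum_eq_zero fun j _ => by
      rw [ih (j.castLT (j.2.trans l.2)) j.2, mul_zero]

lemma gsTransition_mem_rowStochastic {P : A → Matrix (Fin M) (Fin M) ℝ}
    (hP : ∀ a, P a ∈ rowStochastic ℝ (Fin M)) (d : Fin M → A) :
    Matrix.of (gsTransition P d) ∈ rowStochastic ℝ (Fin M) := by
  have h0 : ∀ l j, 0 ≤ gsTransition P d l j := by
    intro l j
    induction l using WellFoundedLT.induction with
    | ind l ih =>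
      rw [gsTransition]
      refine add_nonneg (Finset.sum_nonneg fun i _ =>
        mul_nonneg (nonneg_of_mem_rowStochastic (hP _)) (ih _ i.2)) ?_
      split_ifs
      exacts [nonneg_of_mem_rowStochastic (hP _), le_rfl]
  refine mem_rowStochastic.2 ⟨h0, ?_⟩
  -- with zero rewards, the constant `1` solves the recursion for the iterate of `1`
  have hR : gsReward P (fun _ _ => 0) d = 0 := 
    funext fun l => gsReward_eq_zero (r := fun _ _ => 0) (fun _ => rfl) l
  have hstep := gsReward_add_mulVec_apply P (fun _ _ => 0) d 1
  rw [hR, zero_add] at hstep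
  funext l
  induction l using WellFoundedLT.induction with
  | ind l ih =>
    rw [hstep, Pi.one_apply, zero_add, ← sum_row_of_mem_rowStochastic (hP (d l)) l]
    refine Finset.sum_congr rfl fun j _ => ?_
    split_ifs with hj
    · rw [ih j hj, Pi.one_apply, mul_one]
    · simp

lemma gsReward_add_mulVec_le {P : A → Matrix (Fin M) (Fin M) ℝ} {r : Fin M → A → ℝ}
    (hP : ∀ a l j, 0 ≤ P a l j) {d : Fin M → A} {x y : Fin M → ℝ}
    (h : ∀ l, r l (d l) + ∑ j, P (d l) l j * (if j < l then y j else x j) ≤ y l) :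
    gsReward P r d + Matrix.of (gsTransition P d) *ᵥ x ≤ y := by
  intro l
  induction l using WellFoundedLT.induction with
  | ind l ih =>
    rw [gsReward_add_mulVec_apply]
    refine le_trans ?_ (h l)
    gcongr with j _
    · exact hP _ _ _
    · split_ifs with hj
      exacts [ih j hj, le_rfl]

lemma eq_gsReward_add_mulVec {P : A → Matrix (Fin M) (Fin M) ℝ} {r : Fin M → A → ℝ}
    {d : Fin M → A} {x y : Fin M → ℝ}
    (h : ∀ l, y l = r l (d l) + ∑ j, P (d l) l j * (if j < l then y j else x j)) :
    y = gsReward P r d + Matrix.of (gsTransition P d) *ᵥ x := by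
  funext l
  induction l using WellFoundedLT.induction with
  | ind l ih =>
    rw [gsReward_add_mulVec_apply, h l]
    congr 1
    refine Finset.sum_congr rfl fun j _ => ?_
    split_ifs with hj
    · rw [ih j hj]
    · rfl

end GaussSeidelStep

end Turnpike

namespace Turnpike

namespace ControlledWalk

/-! ### The jumps of the walk -/

section Jumps

variable {M : ℕ} {A : Type*} (w : ControlledWalk M A)

lemma p_coe (a : A) (m : Finset.Icc 1 M) : w.p a m = (w.jump a m).toReal := by
  rw [p, PMF.map_apply, tsum_eq_single m]
  · simp
  · intro b hb
    simp [Subtype.val_injective.ne hb.symm]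

lemma p_nonneg (a : A) (m : ℕ) : 0 ≤ w.p a m := ENNReal.toReal_nonneg

lemma sum_p (a : A) : ∑ m : Finset.Icc 1 M, w.p a m = 1 := by
  simp_rw [p_coe]
  rw [← ENNReal.toReal_sum fun m _ => (w.jump a).apply_ne_top m,
    ← tsum_fintype (L := .unconditional _), PMF.tsum_coe, ENNReal.toReal_one]

lemma L_eq_sum (a : A) : w.L a = ∑ m : Finset.Icc 1 M, (m : ℝ) * w.p a m :=
  (Finset.sum_coe_sort (Finset.Icc 1 M) fun m => (m : ℝ) * w.p a m).symm

lemma L_pos (a : A) : 0 < w.L a := by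
  refine zero_lt_one.trans_le ?_
  rw [L_eq_sum, ← w.sum_p a]
  refine Finset.sum_le_sum fun m _ => le_mul_of_one_le_left (w.p_nonneg a m) ?_
  exact_mod_cast (Finset.mem_Icc.1 m.2).1

lemma next_of_neg {x : State M} (hx : x.1 < 0) (m : Finset.Icc 1 M) : next x m = x := by
  simp [next, not_le.2 hx]

lemma next_val {x : State M} (hx : 0 ≤ x.1) (m : Finset.Icc 1 M) :
    (next x m).1 = x.1 - (m.1 : ℤ) := by
  simp [next, hx]

lemma one_le_jump (m : Finset.Icc 1 M) : (1 : ℤ) ≤ (m.1 : ℤ) := by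
  exact_mod_cast (Finset.mem_Icc.1 m.2).1

end Jumps

/-! ### Solving the Bellman equation by successive approximation -/

section Approximation

variable {M : ℕ} {A : Type*} (w : ControlledWalk M A)

/-- The optimal reward of the walk stopped after `n` steps. -/
noncomputable def finiteHorizonValue : ℕ → State M → ℝ
  | 0, _ => 0
  | n + 1, x => if x.1 < 0 then 0 else
      ⨆ a, (w.R a + ∑ m : Finset.Icc 1 M, finiteHorizonValue n (next x m) * w.p a m)

lemma finiteHorizonValue_of_neg (n : ℕ) {x : State M} (hx : x.1 < 0) :
    w.finiteHorizonValue n x = 0 := by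
  cases n <;> simp [finiteHorizonValue, hx]

lemma finiteHorizonValue_succ {n : ℕ} {x : State M} (hx : x.1 < n) :
    w.finiteHorizonValue (n + 1) x = w.finiteHorizonValue n x := by
  induction n generalizing x with
  | zero => rw [finiteHorizonValue_of_neg _ _ (by simpa using hx),
      finiteHorizonValue_of_neg _ _ (by simpa using hx)]
  | succ n ih =>
    by_cases h : x.1 < 0
    · rw [finiteHorizonValue_of_neg _ _ h, finiteHorizonValue_of_neg _ _ h]
    rw [finiteHorizonValue, finiteHorizonValue, if_neg h, if_neg h]
    congr 1
    funext a
    congr 1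
    refine Finset.sum_congr rfl fun m _ => ?_
    rw [ih]
    rw [next_val (not_lt.1 h)]
    have := one_le_jump m
    push_cast at hx
    omega

lemma finiteHorizonValue_eq_of_lt {n k : ℕ} {x : State M} (hn : x.1 < n) (hk : x.1 < k) :
    w.finiteHorizonValue n x = w.finiteHorizonValue k x := by
  have key : ∀ j, w.finiteHorizonValue (n + j) x = w.finiteHorizonValue n x := fun j => by
    induction j with
    | zero => rfl
    | succ j ih => rw [← add_assoc, finiteHorizonValue_succ w (by push_cast; omega), ih]
  have key' : ∀ j, w.finiteHorizonValue (k + j) x = w.finiteHorizonValue k x := fun j => by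
    induction j with
    | zero => rfl
    | succ j ih => rw [← add_assoc, finiteHorizonValue_succ w (by push_cast; omega), ih]
  rw [← key k, add_comm, key']

/-- The optimality equation for `v`: the right-hand side at each state is an attained upper
bound. -/
structure SolvesBellman (v : State M → ℝ) : Prop where
  eq_zero : ∀ x : State M, x.1 < 0 → v x = 0
  le : ∀ x : State M, 0 ≤ x.1 → ∀ a,
    w.R a + ∑ m : Finset.Icc 1 M, v (next x m) * w.p a m ≤ v x
  exists_eq : ∀ x : State M, 0 ≤ x.1 → ∃ a,
    v x = w.R a + ∑ m : Finset.Icc 1 M, v (next x m) * w.p a m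

lemma exists_solvesBellman [Finite A] [Nonempty A] : ∃ v, w.SolvesBellman v := by
  set v : State M → ℝ := fun x => w.finiteHorizonValue (x.1 + 1).toNat x with hv
  have hsup : ∀ x : State M, 0 ≤ x.1 →
      v x = ⨆ a, (w.R a + ∑ m : Finset.Icc 1 M, v (next x m) * w.p a m) := by
    intro x hx
    have : v x = w.finiteHorizonValue (x.1.toNat + 1) x :=
      w.finiteHorizonValue_eq_of_lt (by omega) (by push_cast; omega)
    rw [this, finiteHorizonValue, if_neg (not_lt.2 hx)]
    congr 1
    funext a
    congr 1
    refine Finset.sum_congr rfl fun m _ => ?_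
    rw [hv, w.finiteHorizonValue_eq_of_lt (k := ((next x m).1 + 1).toNat)]
    · rw [next_val hx]
      have := one_le_jump m
      omega
    · omega
  refine ⟨v, fun x hx => w.finiteHorizonValue_of_neg _ hx, fun x hx a => ?_, fun x hx => ?_⟩
  · rw [hsup x hx]
    exact le_ciSup (f := fun a => w.R a + ∑ m : Finset.Icc 1 M, v (next x m) * w.p a m)
      (Set.finite_range _).bddAbove a
  · obtain ⟨a, ha⟩ := exists_eq_ciSup_of_finite
      (f := fun a => w.R a + ∑ m : Finset.Icc 1 M, v (next x m) * w.p a m)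
    exact ⟨a, (hsup x hx).trans ha.symm⟩

variable {w} in
lemma SolvesBellman.reward_add_le {v : State M → ℝ} (hv : w.SolvesBellman v) (x : State M)
    (a : A) : w.reward x a + ∑ m : Finset.Icc 1 M, v (next x m) * w.p a m ≤ v x := by
  by_cases hx : x.1 < 0
  · simp [reward, hx, next_of_neg hx, hv.eq_zero x hx]
  · rw [reward, if_neg hx]
    exact hv.le x (not_lt.1 hx) a

variable {w} in
lemma SolvesBellman.exists_reward_add_eq [Nonempty A] {v : State M → ℝ} (hv : w.SolvesBellman v)
    (x : State M) :
    ∃ a, w.reward x a + ∑ m : Finset.Icc 1 M, v (next x m) * w.p a m = v x := by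
  by_cases hx : x.1 < 0
  · simp [reward, hx, next_of_neg hx, hv.eq_zero x hx]
  · simp only [reward, if_neg hx]
    obtain ⟨a, ha⟩ := hv.exists_eq x (not_lt.1 hx)
    exact ⟨a, ha.symm⟩

end Approximation

/-! ### The strategic measure -/

section Stage

variable {M : ℕ} {A : Type*}

lemma measurable_stage {β : Type*} [MeasurableSpace β] (g : Stage M A → β) (t : ℕ) :
    Measurable fun ω : ℕ → Stage M A => g (ω t) :=
  Measurable.of_discrete.comp (measurable_pi_apply t)

lemma ae_toMeasure_of_support {α : Type*} [MeasurableSpace α] [DiscreteMeasurableSpace α]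
    (q : PMF α) {s : α → Prop} (h : ∀ z ∈ q.support, s z) : ∀ᵐ z ∂q.toMeasure, s z := by
  rw [ae_iff, PMF.toMeasure_apply_eq_zero_iff _ (MeasurableSet.of_discrete)]
  exact Set.disjoint_left.2 fun z hz hz' => hz' (h z hz)

lemma integral_toMeasure_eq_integral_map {α : Type*} [MeasurableSpace α]
    [DiscreteMeasurableSpace α] (q : PMF α) (f : α → ℝ) :
    ∫ z, f z ∂q.toMeasure = ∫ u, u ∂(q.map f).toMeasure := by
  rw [← PMF.toMeasure_map f q Measurable.of_discrete]
  exact (integral_map (f := fun u : ℝ => u) Measurable.of_discrete.aemeasurable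
    measurable_id.aestronglyMeasurable).symm

end Stage

section StrategicMeasure

variable {M : ℕ} {A : Type*} [Finite A] (w : ControlledWalk M A) (π : Strategy M A) (x : State M)

instance : IsProbabilityMeasure (w.strategicMeasure π x) := by
  unfold strategicMeasure; infer_instance

lemma map_eval_zero_strategicMeasure :
    (w.strategicMeasure π x).map (fun ω => ω 0) = initialLaw π x := by
  have h : (w.strategicMeasure π x).map (Preorder.frestrictLe 0) =
      (initialLaw π x).map
        (MeasurableEquiv.piUnique (fun _ : Finset.Iic 0 => Stage M A)).symm := by
    rw [strategicMeasure, Kernel.trajMeasure, Measure.map_comp _ _ (by fun_prop),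
      Kernel.traj_map_frestrictLe, Kernel.partialTraj_self, Measure.id_comp]
  have h' := congrArg (fun ν => Measure.map (fun y : (_ : Finset.Iic 0) → Stage M A =>
    y ⟨0, Finset.mem_Iic.2 le_rfl⟩) ν) h
  rw [Measure.map_map (by fun_prop) (by fun_prop), Measure.map_map (by fun_prop) (by fun_prop)]
    at h'
  refine h'.trans ?_
  exact Measure.map_id

lemma ae_zero {s : Stage M A → Prop} (h : ∀ a ∈ (π 0 Fin.elim0 x).support, s ⟨x, a⟩) :
    ∀ᵐ ω ∂w.strategicMeasure π x, s (ω 0) := by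
  have h1 : ∀ᵐ z ∂initialLaw π x, s z := by
    refine ae_toMeasure_of_support _ fun z hz => ?_
    obtain ⟨a, ha, rfl⟩ := (PMF.mem_support_map_iff _ _ _).1 hz
    exact h a ha
  rw [← w.map_eval_zero_strategicMeasure π x] at h1
  exact ae_of_ae_map (measurable_pi_apply 0).aemeasurable h1

/-- A relation between two consecutive stages holds almost surely if it holds for all the pairs
which the transition law and the strategy permit. -/
lemma ae_succ (t : ℕ) {s : Stage M A → Stage M A → Prop}
    (h : ∀ (z : Stage M A) (hist : Fin (t + 1) → Stage M A) (m : Finset.Icc 1 M) (a : A),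
      a ∈ (π (t + 1) hist (next z.state m)).support → s z ⟨next z.state m, a⟩) :
    ∀ᵐ ω ∂w.strategicMeasure π x, s (ω t) (ω (t + 1)) := by
  have hmeas : Measurable fun y : ((_ : Finset.Iic t) → Stage M A) × Stage M A =>
      (y.1 ⟨t, Finset.mem_Iic.2 le_rfl⟩, y.2) := by fun_prop
  have h1 : ∀ᵐ y ∂((w.strategicMeasure π x).map (Preorder.frestrictLe t) ⊗ₘ w.stepKernel π t),
      s (y.1 ⟨t, Finset.mem_Iic.2 le_rfl⟩) y.2 := by
    rw [Measure.ae_compProd_iff (p := fun y : ((_ : Finset.Iic t) → Stage M A) × Stage M A =>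
      s (y.1 ⟨t, Finset.mem_Iic.2 le_rfl⟩) y.2)
      (hmeas (MeasurableSet.of_discrete (s := {y : Stage M A × Stage M A | s y.1 y.2})))]
    refine ae_of_all _ fun y => ae_toMeasure_of_support _ fun z hz => ?_
    obtain ⟨x', hx', hz⟩ := (PMF.mem_support_bind_iff _ _ _).1 hz
    obtain ⟨m, -, rfl⟩ := (PMF.mem_support_map_iff _ _ _).1 hx'
    obtain ⟨a, ha, rfl⟩ := (PMF.mem_support_map_iff _ _ _).1 hz
    exact h _ _ m a ha
  rw [strategicMeasure, Kernel.map_frestrictLe_trajMeasure_compProd_eq_map_trajMeasure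
    (X := fun _ => Stage M A)] at h1
  exact ae_of_ae_map (by fun_prop) h1

lemma ae_state_zero : ∀ᵐ ω ∂w.strategicMeasure π x, (ω 0).state = x :=
  w.ae_zero π x (s := fun z => z.state = x) fun _ _ => rfl

/-- Before it is absorbed the walk decreases at each step. -/
lemma ae_state_le : ∀ᵐ ω ∂w.strategicMeasure π x,
    ∀ t : ℕ, (ω t).state.1 ≤ x.1 ∧ ((ω t).state.1 < 0 ∨ (ω t).state.1 ≤ x.1 - t) := by
  have h : ∀ᵐ ω ∂w.strategicMeasure π x, ∀ t, ∃ m, (ω (t + 1)).state = next (ω t).state m :=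
    ae_all_iff.2 fun t => w.ae_succ π x t
      (s := fun z z' => ∃ m, z'.state = next z.state m) fun z _ m a _ => ⟨m, rfl⟩
  filter_upwards [h, w.ae_state_zero π x] with ω hω hω0 t
  induction t with
  | zero => simp [hω0]
  | succ t ih =>
    obtain ⟨m, hm⟩ := hω t
    rw [hm]
    by_cases hneg : (ω t).state.1 < 0
    · rw [next_of_neg hneg]
      exact ⟨ih.1, Or.inl hneg⟩
    · rw [next_val (not_lt.1 hneg)]
      have := one_le_jump m
      push_cast
      omega

lemma finite_stage_le : {z : Stage M A | z.state.1 ≤ x.1}.Finite := by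
  have hS : {y : State M | y.1 ≤ x.1}.Finite :=
    Set.Finite.of_finite_image (f := Subtype.val)
      ((Set.finite_Icc (-(M : ℤ)) x.1).subset (by rintro _ ⟨y, hy, rfl⟩; exact ⟨y.2, hy⟩))
      Subtype.val_injective.injOn
  refine Set.Finite.of_finite_image (f := fun z : Stage M A => (z.state, z.action))
    ((hS.prod Set.finite_univ).subset ?_) ?_
  · rintro _ ⟨z, hz, rfl⟩
    exact ⟨hz, Set.mem_univ _⟩
  · rintro ⟨_, _⟩ _ ⟨_, _⟩ _ h
    simpa using h

lemma integrable_stage (g : Stage M A → ℝ) (t : ℕ) :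
    Integrable (fun ω : ℕ → Stage M A => g (ω t)) (w.strategicMeasure π x) := by
  obtain ⟨C, hC⟩ := ((finite_stage_le (A := A) x).image fun z => ‖g z‖).bddAbove
  refine Integrable.of_bound (measurable_stage g t).aestronglyMeasurable C ?_
  filter_upwards [w.ae_state_le π x] with ω hω
  exact hC ⟨ω t, (hω t).1, rfl⟩

lemma integral_state_stepKernel (g : State M → ℝ) (t : ℕ)
    (y : (_ : Finset.Iic t) → Stage M A) :
    ∫ z, g z.state ∂w.stepKernel π t y = ∑ m : Finset.Icc 1 M,
      g (next (y ⟨t, Finset.mem_Iic.2 le_rfl⟩).state m) *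
        w.p (y ⟨t, Finset.mem_Iic.2 le_rfl⟩).action m := by
  set z₀ := y ⟨t, Finset.mem_Iic.2 le_rfl⟩
  let hist : Fin (t + 1) → Stage M A := fun k => y ⟨k, Finset.mem_Iic.2 (Nat.lt_succ_iff.1 k.2)⟩
  set q : PMF (Stage M A) := (w.transition z₀.state z₀.action).bind fun y' =>
    (π (t + 1) hist y').map fun a => (⟨y', a⟩ : Stage M A) with hq
  have hκ : w.stepKernel π t y = q.toMeasure := rfl
  have hmap : q.map (fun z => g z.state) =
      (w.jump z₀.action).map fun m => g (next z₀.state m) := by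
    have hconst : ∀ y', ((π (t + 1) hist y').map fun a => (⟨y', a⟩ : Stage M A)).map
        (fun z => g z.state) = PMF.pure (g y') := fun y' => by
      rw [PMF.map_comp]
      exact PMF.map_const (π (t + 1) hist y') (g y')
    rw [hq, PMF.map_bind]
    simp only [hconst]
    change (w.transition z₀.state z₀.action).map g = _
    rw [transition, PMF.map_comp]
    rfl
  rw [hκ, integral_toMeasure_eq_integral_map q, hmap, ← integral_toMeasure_eq_integral_map,
    PMF.integral_eq_sum]
  refine Finset.sum_congr rfl fun m _ => ?_
  rw [p_coe, smul_eq_mul, mul_comm]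

lemma integral_state_succ (g : State M → ℝ) (t : ℕ) :
    ∫ ω, g (ω (t + 1)).state ∂w.strategicMeasure π x =
      ∫ ω, ∑ m : Finset.Icc 1 M, g (next (ω t).state m) * w.p (ω t).action m
        ∂w.strategicMeasure π x := by
  have hlaw : (w.strategicMeasure π x).map (Preorder.frestrictLe t) ⊗ₘ w.stepKernel π t =
      (w.strategicMeasure π x).map (fun ω => (Preorder.frestrictLe t ω, ω (t + 1))) :=
    Kernel.map_frestrictLe_trajMeasure_compProd_eq_map_trajMeasure (X := fun _ => Stage M A)
  have hf : Measurable fun y : ((_ : Finset.Iic t) → Stage M A) × Stage M A => g y.2.state :=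
    (Measurable.of_discrete (f := fun z : Stage M A => g z.state)).comp measurable_snd
  have hpair : Measurable fun ω : ℕ → Stage M A =>
      (Preorder.frestrictLe (π := fun _ => Stage M A) t ω, ω (t + 1)) := by fun_prop
  have h1 : ∫ ω, g (ω (t + 1)).state ∂w.strategicMeasure π x =
      ∫ y, g y.2.state
        ∂((w.strategicMeasure π x).map (Preorder.frestrictLe t) ⊗ₘ w.stepKernel π t) := by
    rw [hlaw, integral_map hpair.aemeasurable hf.aestronglyMeasurable]
  have hint : Integrable (fun y : ((_ : Finset.Iic t) → Stage M A) × Stage M A => g y.2.state)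
      ((w.strategicMeasure π x).map (Preorder.frestrictLe t) ⊗ₘ w.stepKernel π t) := by
    rw [hlaw, integrable_map_measure hf.aestronglyMeasurable hpair.aemeasurable]
    exact w.integrable_stage π x (fun z => g z.state) (t + 1)
  rw [h1, Measure.integral_compProd hint]
  simp_rw [w.integral_state_stepKernel π g t]
  rw [integral_map (by fun_prop)]
  · rfl
  · refine Measurable.aestronglyMeasurable ?_
    exact (Measurable.of_discrete (f := fun z : Stage M A => ∑ m : Finset.Icc 1 M,
      g (next z.state m) * w.p z.action m)).comp (measurable_pi_apply _)

lemma totalReward_eq_sum : w.totalReward π x = ∑ t ∈ Finset.range (x.1 + 1).toNat,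
    ∫ ω, w.reward (ω t).state (ω t).action ∂w.strategicMeasure π x := by
  rw [← integral_finsetSum _ fun t _ =>
    w.integrable_stage π x (fun z => w.reward z.state z.action) t, totalReward]
  refine integral_congr_ae ?_
  filter_upwards [w.ae_state_le π x] with ω hω
  refine tsum_eq_sum fun t ht => ?_
  have h1 := (hω t).2
  rw [Finset.mem_range, not_lt] at ht
  rw [reward, if_pos (by omega)]

end StrategicMeasure

/-! ### The Bellman function -/

section BellmanFunction

variable {M : ℕ} {A : Type*} [Finite A] (w : ControlledWalk M A)

variable {w} in
/-- The total reward plus the expected one-step losses in the Bellman equation is `v x`, as the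
expectations of `v` at the successive states telescope. -/
lemma SolvesBellman.totalReward_add_sum_loss {v : State M → ℝ} (hv : w.SolvesBellman v)
    (π : Strategy M A) (x : State M) :
    w.totalReward π x + ∑ t ∈ Finset.range (x.1 + 1).toNat,
      ∫ ω, (v (ω t).state - (w.reward (ω t).state (ω t).action +
        ∑ m : Finset.Icc 1 M, v (next (ω t).state m) * w.p (ω t).action m))
        ∂w.strategicMeasure π x = v x := by
  set ν := w.strategicMeasure π x
  have hI := w.integrable_stage π x
  have hloss : ∀ t, ∫ ω, (v (ω t).state - (w.reward (ω t).state (ω t).action +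
        ∑ m : Finset.Icc 1 M, v (next (ω t).state m) * w.p (ω t).action m)) ∂ν =
      ∫ ω, v (ω t).state ∂ν - ∫ ω, w.reward (ω t).state (ω t).action ∂ν -
        ∫ ω, v (ω (t + 1)).state ∂ν := by
    intro t
    have h1 := hI (fun z => v z.state) t
    have h2 := hI (fun z => w.reward z.state z.action) t
    have h3 := hI (fun z => ∑ m : Finset.Icc 1 M, v (next z.state m) * w.p z.action m) t
    have h23 : Integrable (fun ω => w.reward (ω t).state (ω t).action +
        ∑ m : Finset.Icc 1 M, v (next (ω t).state m) * w.p (ω t).action m) ν := h2.add h3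
    rw [integral_sub h1 h23, integral_add h2 h3, ← w.integral_state_succ π x v t,
      sub_sub]
  have hstart : ∫ ω, v (ω 0).state ∂ν = v x := by
    have : ∀ᵐ ω ∂ν, v (ω 0).state = v x :=
      (w.ae_state_zero π x).mono fun ω hω => by rw [hω]
    rw [integral_congr_ae this]
    simp
  have hend : ∫ ω, v (ω (x.1 + 1).toNat).state ∂ν = 0 := by
    have : ∀ᵐ ω ∂ν, v (ω (x.1 + 1).toNat).state = 0 := by
      filter_upwards [w.ae_state_le π x] with ω hω
      have := (hω (x.1 + 1).toNat).2
      exact hv.eq_zero _ (by omega)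
    rw [integral_congr_ae this]
    simp
  rw [totalReward_eq_sum, ← Finset.sum_add_distrib]
  have : ∀ t, ∫ ω, w.reward (ω t).state (ω t).action ∂ν +
      ∫ ω, (v (ω t).state - (w.reward (ω t).state (ω t).action +
        ∑ m : Finset.Icc 1 M, v (next (ω t).state m) * w.p (ω t).action m)) ∂ν =
      ∫ ω, v (ω t).state ∂ν - ∫ ω, v (ω (t + 1)).state ∂ν := fun t => by
    rw [hloss]
    ring
  rw [Finset.sum_congr rfl fun t _ => this t,
    Finset.sum_range_sub' fun t => ∫ ω, v (ω t).state ∂ν, hstart, hend, sub_zero]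

/-- Every solution of the Bellman equation is the Bellman function, whose supremum is attained by
the strategy which follows the maximising actions. -/
lemma SolvesBellman.eq_V [Nonempty A] {v : State M → ℝ} (hv : w.SolvesBellman v) : v = w.V := by
  funext x
  have hle : ∀ π : Strategy M A, w.totalReward π x ≤ v x := by
    intro π
    rw [← hv.totalReward_add_sum_loss π x]
    refine le_add_of_nonneg_right (Finset.sum_nonneg fun t _ => integral_nonneg fun ω => ?_)
    exact sub_nonneg.2 (hv.reward_add_le _ _)
  choose best hbest using hv.exists_reward_add_eq
  let π : Strategy M A := fun _ _ y => PMF.pure (best y)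
  have hπ : ∀ᵐ ω ∂w.strategicMeasure π x, ∀ t, (ω t).action = best (ω t).state := by
    refine ae_all_iff.2 fun t => ?_
    cases t with
    | zero =>
      refine w.ae_zero π x (s := fun z => z.action = best z.state) fun a ha => ?_
      simpa [π] using ha
    | succ t =>
      refine w.ae_succ π x t (s := fun _ z => z.action = best z.state) fun z hist m a ha => ?_
      simpa [π] using ha
  have heq : w.totalReward π x = v x := by
    rw [← hv.totalReward_add_sum_loss π x, left_eq_add]
    refine Finset.sum_eq_zero fun t _ => integral_eq_zero_of_ae ?_
    filter_upwards [hπ] with ω hω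
    rw [hω t, hbest, sub_self, Pi.zero_apply]
  have : Nonempty (Strategy M A) := ⟨π⟩
  exact le_antisymm (heq.symm.le.trans
    (le_ciSup (f := fun π => w.totalReward π x) ⟨v x, by rintro _ ⟨π, rfl⟩; exact hle π⟩ π))
    (ciSup_le hle)

lemma solvesBellman_V [Nonempty A] : w.SolvesBellman w.V := by
  obtain ⟨v, hv⟩ := w.exists_solvesBellman
  rwa [← hv.eq_V]

end BellmanFunction

end ControlledWalk

end Turnpike

namespace Turnpike

open Matrix

namespace ControlledWalk

/-! ### The reduced rewards and the associated model -/

section ReducedModel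

variable {M : ℕ} {A : Type*} (w : ControlledWalk M A)

lemma r_eq (s : Fin M) (a : A) : w.r s a = w.R a - w.cStar * w.L a := by
  have := (w.L_pos a).ne'
  rw [r]
  field_simp

lemma r_nonpos [Finite A] (s : Fin M) (a : A) : w.r s a ≤ 0 :=
  mul_nonpos_of_nonneg_of_nonpos (w.L_pos a).le <| sub_nonpos.2 <|
    le_ciSup (f := fun a => w.R a / w.L a) (Set.finite_range _).bddAbove a

lemma r_eq_zero_iff (s : Fin M) (a : A) : w.r s a = 0 ↔ a ∈ w.AStar := by
  rw [r, mul_eq_zero, or_iff_right (w.L_pos a).ne', sub_eq_zero]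
  rfl

lemma AStar_nonempty [Finite A] [Nonempty A] : w.AStar.Nonempty :=
  exists_eq_ciSup_of_finite (f := fun a => w.R a / w.L a)

/-- The state `n M + s`, at the residue `s` of the `n`-th block of `M` consecutive states. -/
def blockState (n : ℕ) (s : Fin M) : State M :=
  ⟨(n * M + s : ℕ), by omega⟩

/-- A jump from the block `n + 1` leads to a smaller residue in the same block, or to a residue
which is not smaller in the preceding one. -/
lemma sum_next_blockState (g : State M → ℝ) (a : A) (n : ℕ) (l : Fin M) :
    ∑ m : Finset.Icc 1 M, g (next (blockState (n + 1) l) m) * w.p a m =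
      ∑ j, w.P a l j * (if j < l then g (blockState (n + 1) j) else g (blockState n j)) := by
  have hl := l.2
  refine Finset.sum_bij' (fun m _ => if h : m.1 ≤ l.1 then ⟨l.1 - m.1, by omega⟩
      else ⟨M + l.1 - m.1, by omega⟩)
    (fun j _ => ⟨if j < l then l.1 - j.1 else M + l.1 - j.1, by
      have := j.2
      rw [Finset.mem_Icc]
      split_ifs with h
      · rw [Fin.lt_def] at h
        omega
      · rw [Fin.lt_def] at h
        omega⟩)
    (fun _ _ => Finset.mem_univ _) (fun _ _ => Finset.mem_univ _) ?_ ?_ ?_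
  · rintro ⟨m, hm⟩ -
    rw [Finset.mem_Icc] at hm
    apply Subtype.ext
    by_cases h : m ≤ l.1
    · have h1 : l.1 - m < l.1 := by omega
      simp only [h, dite_true, Fin.lt_def, h1, if_true]
      omega
    · have h1 : ¬ M + l.1 - m < l.1 := by omega
      simp only [h, dite_false, Fin.lt_def, h1, if_false]
      omega
  · rintro j -
    have := j.2
    apply Fin.ext
    by_cases h : j.1 < l.1
    · simp only [Fin.lt_def, h, if_true, Nat.sub_le, dite_true]
      omega
    · have h1 : ¬ M + l.1 - j.1 ≤ l.1 := by omega
      simp only [Fin.lt_def, h, if_false, h1, dite_false]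
      omega
  · rintro ⟨m, hm⟩ -
    have hm' := Finset.mem_Icc.1 hm
    have hpos : 0 ≤ (blockState (n + 1) l).1 := Int.natCast_nonneg _
    by_cases h : m ≤ l.1
    · have h1 : l.1 - m < l.1 := by omega
      have h2 : next (blockState (n + 1) l) ⟨m, hm⟩ =
          blockState (n + 1) ⟨l.1 - m, by omega⟩ := by
        apply Subtype.ext
        rw [next_val hpos]
        simp only [blockState]
        omega
      have h3 : l.1 - (l.1 - m) = m := by omega
      simp only [h, dite_true, Fin.lt_def, h1, if_true, h2, P, Matrix.of_apply, h3]
      ring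
    · have h1 : ¬ M + l.1 - m < l.1 := by omega
      have h2 : next (blockState (n + 1) l) ⟨m, hm⟩ =
          blockState n ⟨M + l.1 - m, by omega⟩ := by
        apply Subtype.ext
        rw [next_val hpos]
        simp only [blockState, add_mul, one_mul]
        omega
      have h3 : M + l.1 - (M + l.1 - m) = m := by omega
      simp only [h, dite_false, Fin.lt_def, h1, if_false, h2, P, Matrix.of_apply, h3]
      ring

lemma P_mem_rowStochastic (a : A) : w.P a ∈ rowStochastic ℝ (Fin M) := by
  refine mem_rowStochastic_iff_sum.2 ⟨fun s j => ?_, fun s => ?_⟩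
  · simp only [P, Matrix.of_apply]
    split_ifs <;> exact w.p_nonneg _ _
  · have := w.sum_next_blockState (fun _ => 1) a 0 s
    simp only [one_mul, w.sum_p, ite_self, mul_one] at this
    exact this.symm

lemma decisionMatrix_mem_rowStochastic (d : Fin M → A) :
    w.decisionMatrix d ∈ rowStochastic ℝ (Fin M) :=
  gsTransition_mem_rowStochastic w.P_mem_rowStochastic d

lemma P_nonneg (a : A) (l j : Fin M) : 0 ≤ w.P a l j :=
  nonneg_of_mem_rowStochastic (w.P_mem_rowStochastic a)

variable [Finite A]

lemma decisionReward_nonpos (d : Fin M → A) : w.decisionReward d ≤ 0 := fun l =>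
  gsReward_nonpos w.P_nonneg w.r_nonpos d l

/-- As all rewards are nonpositive, a decision of zero gain is average optimal. -/
lemma isAverageOptimal_of_gain_eq_zero {d : Fin M → A}
    (h : limitingMatrix (w.decisionMatrix d) *ᵥ w.decisionReward d = 0) :
    w.IsAverageOptimal d := by
  intro d'
  rw [h]
  have := mulVec_mono
    (limitingMatrix_mem_rowStochastic (w.decisionMatrix_mem_rowStochastic d'))
    (w.decisionReward_nonpos d')
  rwa [mulVec_zero] at this

lemma isAverageOptimal_const {a : A} (ha : a ∈ w.AStar) : w.IsAverageOptimal fun _ => a := by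
  apply isAverageOptimal_of_gain_eq_zero
  have : w.decisionReward (fun _ => a) = 0 :=
    funext fun l => gsReward_eq_zero (fun l => (w.r_eq_zero_iff l a).2 ha) l
  rw [this, mulVec_zero]

/-- A decision which conserves some vector `h` has gain zero. When its chain has no transient
states, its rewards vanish at all states, so that it only uses actions of `A_*`. -/
lemma mem_AStar_of_eq_add_mulVec
    (hrec : ∀ d : Fin M → A, w.IsAverageOptimal d → ∀ s, ¬ IsTransient (w.decisionMatrix d) s)
    {d : Fin M → A} {h : Fin M → ℝ} (hd : h = w.decisionReward d + w.decisionMatrix d *ᵥ h)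
    (l : Fin M) : d l ∈ w.AStar := by
  have hQ := w.decisionMatrix_mem_rowStochastic d
  have hR : w.decisionReward d = h - w.decisionMatrix d *ᵥ h := eq_sub_of_add_eq hd.symm
  have hopt : w.IsAverageOptimal d := by
    apply isAverageOptimal_of_gain_eq_zero
    rw [hR, mulVec_sub, mulVec_mulVec, limitingMatrix_mul hQ, sub_self]
  obtain ⟨μ, hμ0, hμ⟩ := exists_pos_vecMul_eq hQ (hrec d hopt)
  have hsum : ∑ s, μ s * w.decisionReward d s = 0 := by
    change μ ⬝ᵥ w.decisionReward d = 0
    rw [hR, dotProduct_sub, dotProduct_mulVec, hμ, sub_self]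
  have hl := (Finset.sum_eq_zero_iff_of_nonpos fun s _ => mul_nonpos_of_nonneg_of_nonpos
    (hμ0 s).le (w.decisionReward_nonpos d s)).1 hsum l (Finset.mem_univ l)
  have hRl : gsReward w.P w.r d l = 0 := (mul_eq_zero.1 hl).resolve_left (hμ0 l).ne'
  refine (w.r_eq_zero_iff l _).1 (le_antisymm (w.r_nonpos _ _) ?_)
  rw [← hRl]
  exact gsReward_le w.P_nonneg w.r_nonpos d l

lemma isAperiodic_of_isAverageOptimal
    (hrec : ∀ d : Fin M → A, w.IsAverageOptimal d → ∀ s, ¬ IsTransient (w.decisionMatrix d) s)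
    (hmix : (∃ J : ℕ, 1 ≤ J ∧ gammaCoeff w.decisionMatrix J < 1) ∨
      ∀ d : Fin M → A, w.IsAverageOptimal d → IsAperiodic (w.decisionMatrix d))
    {d : Fin M → A} (hd : w.IsAverageOptimal d) : IsAperiodic (w.decisionMatrix d) := by
  rcases hmix with ⟨J, hJ, hγ⟩ | hap
  · exact isAperiodic_of_forall_exists_pow_pos (w.decisionMatrix_mem_rowStochastic d) (hrec d hd)
      hJ fun s u => exists_pow_pos_of_gammaCoeff_lt_one d hγ s u
  · exact hap d hd

end ReducedModel

/-! ### The relative values -/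

section RelativeValue

variable {M : ℕ} {A : Type*} [Finite A] (w : ControlledWalk M A)

/-- The relative value `V(i) - c_* i`. -/
noncomputable def relValue (x : State M) : ℝ := w.V x - w.cStar * x.1

/-- The relative values `V(n M + s) - c_* (n M + s)` in the `n`-th block. -/
noncomputable def blockValue (n : ℕ) (s : Fin M) : ℝ := w.relValue (blockState n s)

lemma bellmanExpr_sub (s : Fin M) {x : State M} (hx : 0 ≤ x.1) (a : A) :
    w.bellmanExpr x a - w.cStar * x.1 =
      w.r s a + ∑ m : Finset.Icc 1 M, w.relValue (next x m) * w.p a m := by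
  have h1 : ∀ m : Finset.Icc 1 M, w.relValue (next x m) * w.p a m =
      w.V (next x m) * w.p a m - w.cStar * x.1 * w.p a m + w.cStar * ((m : ℝ) * w.p a m) := by
    intro m
    rw [relValue, next_val hx]
    push_cast
    ring
  simp only [h1, Finset.sum_add_distrib, Finset.sum_sub_distrib, ← Finset.mul_sum, w.sum_p,
    ← w.L_eq_sum, bellmanExpr, r_eq]
  ring

variable [Nonempty A]

lemma relValue_ge (s : Fin M) {x : State M} (hx : 0 ≤ x.1) (a : A) :
    w.r s a + ∑ m : Finset.Icc 1 M, w.relValue (next x m) * w.p a m ≤ w.relValue x := by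
  rw [← bellmanExpr_sub w s hx a]
  exact sub_le_sub_right (w.solvesBellman_V.le x hx a) _

lemma relValue_eq (s : Fin M) {x : State M} (hx : 0 ≤ x.1) {a : A}
    (ha : ∀ b, w.bellmanExpr x b ≤ w.bellmanExpr x a) :
    w.relValue x = w.r s a + ∑ m : Finset.Icc 1 M, w.relValue (next x m) * w.p a m := by
  rw [← bellmanExpr_sub w s hx a, relValue]
  congr 1
  obtain ⟨b, hb⟩ := w.solvesBellman_V.exists_eq x hx
  exact le_antisymm (hb.le.trans (ha b)) (w.solvesBellman_V.le x hx a)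

lemma abs_relValue_le (s : Fin M) (x : State M) : |w.relValue x| ≤ |w.cStar| * M := by
  have key : ∀ n : ℕ, ∀ x : State M, x.1 < n → |w.relValue x| ≤ |w.cStar| * M := by
    intro n
    induction n with
    | zero =>
      intro x hx
      rw [relValue, w.solvesBellman_V.eq_zero x hx, zero_sub, abs_neg, abs_mul]
      gcongr
      rw [abs_le]
      have h1 := x.2
      constructor
      · exact_mod_cast h1
      · exact_mod_cast (by omega : x.1 ≤ M)
    | succ n ih =>
      intro x hx
      by_cases hneg : x.1 < 0
      · exact ih x (by omega)
      have hx0 := not_lt.1 hneg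
      have hnext : ∀ m, |w.relValue (next x m)| ≤ |w.cStar| * M := fun m => ih _ (by
        rw [next_val hx0]
        have := one_le_jump m
        push_cast at hx
        omega)
      have hC : ∀ a, ∑ m : Finset.Icc 1 M, |w.cStar| * M * w.p a m = |w.cStar| * M := fun a => by
        rw [← Finset.mul_sum, w.sum_p, mul_one]
      refine abs_le.2 ⟨?_, ?_⟩
      · obtain ⟨a, ha⟩ := w.AStar_nonempty
        refine le_trans ?_ (w.relValue_ge s hx0 a)
        rw [(w.r_eq_zero_iff s a).2 ha, zero_add, ← hC a, ← Finset.sum_neg_distrib]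
        refine Finset.sum_le_sum fun m _ => ?_
        rw [← neg_mul]
        exact mul_le_mul_of_nonneg_right (abs_le.1 (hnext m)).1 (w.p_nonneg a m)
      · obtain ⟨a, ha⟩ := Finite.exists_max (w.bellmanExpr x)
        rw [w.relValue_eq s hx0 ha, ← hC a]
        refine (add_le_of_nonpos_left (w.r_nonpos s a)).trans (Finset.sum_le_sum fun m _ => ?_)
        exact mul_le_mul_of_nonneg_right (abs_le.1 (hnext m)).2 (w.p_nonneg a m)
  exact key (x.1 + 1).toNat x (by omega)

lemma le_blockValue_succ (d : Fin M → A) (n : ℕ) :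
    w.decisionReward d + w.decisionMatrix d *ᵥ w.blockValue n ≤ w.blockValue (n + 1) := by
  refine gsReward_add_mulVec_le w.P_nonneg fun l => ?_
  have := w.relValue_ge l (x := blockState (n + 1) l) (Int.natCast_nonneg _) (d l)
  rwa [sum_next_blockState] at this

lemma blockValue_succ_eq {d : Fin M → A} {n : ℕ}
    (hd : ∀ l b, w.bellmanExpr (blockState (n + 1) l) b ≤
      w.bellmanExpr (blockState (n + 1) l) (d l)) :
    w.blockValue (n + 1) = w.decisionReward d + w.decisionMatrix d *ᵥ w.blockValue n := by
  refine eq_gsReward_add_mulVec fun l => ?_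
  have := w.relValue_eq l (x := blockState (n + 1) l) (Int.natCast_nonneg _) (hd l)
  rwa [sum_next_blockState] at this

/-- The relative values of consecutive blocks approach each other: for a constant decision in
`A_*`, which has zero rewards, `|c_*| M - blockValue` is a nonnegative sequence as in
`tendsto_succ_sub_of_le_mulVec`. -/
lemma tendsto_blockValue_succ_sub
    (hrec : ∀ d : Fin M → A, w.IsAverageOptimal d → ∀ s, ¬ IsTransient (w.decisionMatrix d) s)
    (hap : ∀ d : Fin M → A, w.IsAverageOptimal d → IsAperiodic (w.decisionMatrix d)) :
    Tendsto (fun n => w.blockValue (n + 1) - w.blockValue n) atTop (𝓝 0) := by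
  obtain ⟨a, ha⟩ := w.AStar_nonempty
  have hopt := w.isAverageOptimal_const ha
  have hQ := w.decisionMatrix_mem_rowStochastic fun _ => a
  have hR : w.decisionReward (fun _ => a) = 0 :=
    funext fun l => gsReward_eq_zero (fun l => (w.r_eq_zero_iff l a).2 ha) l
  obtain ⟨μ, hμ0, hμ⟩ := exists_pos_vecMul_eq hQ (hrec _ hopt)
  obtain ⟨N, hN⟩ := exists_forall_pow_self_pos hQ (hrec _ hopt) (hap _ hopt)
  refine tendsto_pi_nhds.2 fun s => ?_
  have := tendsto_succ_sub_of_le_mulVec (U := fun n s => |w.cStar| * M - w.blockValue n s)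
    hQ hμ0 hμ hN (fun n s => sub_nonneg.2 (abs_le.1 (w.abs_relValue_le s _)).2) (fun n l => ?_) s
  · simpa using this.neg
  · have hW := w.le_blockValue_succ (fun _ => a) n l
    rw [hR, zero_add] at hW
    have hsub : (w.decisionMatrix (fun _ => a) *ᵥ fun s => |w.cStar| * M - w.blockValue n s) l =
        |w.cStar| * M - (w.decisionMatrix (fun _ => a) *ᵥ w.blockValue n) l := by
      simp only [mulVec, dotProduct, mul_sub, Finset.sum_sub_distrib, ← Finset.sum_mul,
        sum_row_of_mem_rowStochastic hQ, one_mul]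
    rw [hsub]
    exact sub_le_sub_left hW _

/-- A decision which is conserving for infinitely many blocks only uses actions of `A_*`: along a
subsequence the block values, and with them their successors, tend to a vector which the decision
conserves. -/
lemma mem_AStar_of_frequently
    (hrec : ∀ d : Fin M → A, w.IsAverageOptimal d → ∀ s, ¬ IsTransient (w.decisionMatrix d) s)
    (hap : ∀ d : Fin M → A, w.IsAverageOptimal d → IsAperiodic (w.decisionMatrix d))
    {d : Fin M → A} (hd : ∃ᶠ n in atTop,
      w.blockValue (n + 1) = w.decisionReward d + w.decisionMatrix d *ᵥ w.blockValue n)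
    (l : Fin M) : d l ∈ w.AStar := by
  obtain ⟨φ, hφ, hφd⟩ := extraction_of_frequently_atTop hd
  have hcpt : IsCompact (Set.univ.pi fun _ : Fin M =>
      Set.Icc (-(|w.cStar| * M)) (|w.cStar| * M)) := isCompact_univ_pi fun _ => isCompact_Icc
  obtain ⟨h, -, ψ, hψ, hlim⟩ := hcpt.tendsto_subseq (x := fun k => w.blockValue (φ k))
    fun k s _ => abs_le.1 (w.abs_relValue_le s _)
  have hnext : Tendsto (fun k => w.blockValue (φ (ψ k) + 1)) atTop (𝓝 h) := by
    have := ((w.tendsto_blockValue_succ_sub hrec hap).comp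
      (hφ.tendsto_atTop.comp hψ.tendsto_atTop)).add hlim
    simpa [Function.comp_def] using this
  have hnext' : Tendsto (fun k => w.blockValue (φ (ψ k) + 1)) atTop
      (𝓝 (w.decisionReward d + w.decisionMatrix d *ᵥ h)) := by
    simp only [hφd]
    exact ((continuous_const.add (continuous_const.matrix_mulVec continuous_id)).tendsto h).comp
      hlim
  exact w.mem_AStar_of_eq_add_mulVec hrec (tendsto_nhds_unique hnext hnext') l

end RelativeValue

end ControlledWalk

end Turnpike

theorem theorem3 {A : Type*} [Fintype A] [Nonempty A] {M : ℕ} (hM : 1 ≤ M)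
    (w : Turnpike.ControlledWalk M A)
    (hrec : ∀ d : Fin M → A, w.IsAverageOptimal d →
      ∀ s, ¬ Turnpike.IsTransient (w.decisionMatrix d) s)
    (hmix : (∃ J : ℕ, 1 ≤ J ∧ Turnpike.gammaCoeff w.decisionMatrix J < 1) ∨
      ∀ d : Fin M → A, w.IsAverageOptimal d → Turnpike.IsAperiodic (w.decisionMatrix d)) :
    ∃ I : ℕ, ∀ x : Turnpike.State M, (I : ℤ) ≤ x.1 →
      ∀ a : A, (∀ b : A, w.bellmanExpr x b ≤ w.bellmanExpr x a) → a ∈ w.AStar := by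
  have hap : ∀ d : Fin M → A, w.IsAverageOptimal d → Turnpike.IsAperiodic (w.decisionMatrix d) :=
    fun d hd => w.isAperiodic_of_isAverageOptimal hrec hmix hd
  have hev : ∀ d : Fin M → A, ∀ᶠ n in atTop,
      w.blockValue (n + 1) = w.decisionReward d + (w.decisionMatrix d).mulVec (w.blockValue n) →
        ∀ l, d l ∈ w.AStar := by
    intro d
    by_cases hd : ∀ l, d l ∈ w.AStar
    · exact Eventually.of_forall fun _ _ => hd
    · refine (not_frequently.1 fun hfreq => hd fun l =>
        w.mem_AStar_of_frequently hrec hap hfreq l).mono fun n hn heq => (hn heq).elim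
  obtain ⟨N, hN⟩ := eventually_atTop.1 (eventually_all.2 hev)
  refine ⟨(N + 1) * M, fun x hx a ha => ?_⟩
  obtain ⟨k, hk⟩ := Int.eq_ofNat_of_zero_le ((Int.natCast_nonneg _).trans hx)
  rw [hk] at hx
  have hkM : N + 1 ≤ k / M := (Nat.le_div_iff_mul_le (by omega)).2 (by exact_mod_cast hx)
  obtain ⟨n, hn⟩ := Nat.exists_eq_add_of_le' (show 1 ≤ k / M by omega)
  set l : Fin M := ⟨k % M, Nat.mod_lt _ (by omega)⟩
  have hxl : x = Turnpike.ControlledWalk.blockState (n + 1) l := by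
    apply Subtype.ext
    rw [hk, Turnpike.ControlledWalk.blockState, ← hn]
    exact congrArg Nat.cast (Nat.div_add_mod' k M).symm
  -- the maximising action `a` at `x` is part of a decision maximising in the whole block of `x`
  choose best hbest using fun j : Fin M =>
    Finite.exists_max (w.bellmanExpr (Turnpike.ControlledWalk.blockState (n + 1) j))
  have hmem := hN n (by omega) (Function.update best l a) (w.blockValue_succ_eq fun j b => ?_) l
  · simpa using hmem
  · rcases eq_or_ne j l with rfl | hj
    · rw [Function.update_self, ← hxl]
      exact ha b
    · rw [Function.update_of_ne hj]
      exact hbest j b
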